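/- Let $X$ be a non-empty compact Hausdorff space, let $\sigma:X\to X$ be a homeomorphism, and let $\mathbb Z$ act on $X$ by $n\cdot x=\sigma^n(x)$. Write $X/\mathbb Z$ for the orbit space with the quotient topology and $\mathbb T$ for the unit circle. Let $\alpha(f)=f\circ\sigma^{-1}$ for $f\in C(X)$ (complex-valued continuous functions, with the supremum norm), and let $$\ell^1(\Sigma)=\Big\{a:\mathbb Z\to C(X)\ :\ \|a\|=\sum_{n\in\mathbb Z}\|a(n)\|<\infty\Big\}$$ be the unital complex Banach algebra associated with $\Sigma=(X,\sigma)$, with the twisted convolution product $(ab)(n)=\sum_{k\in\mathbb Z}a(k)\,\alpha^k(b(n-k))$. The structure space $\Pi_{\ell^1(\Sigma)}$ is the set of primitive ideals of $\ell^1(\Sigma)$, i.e. of kernels of representations $\pi$ of $\ell^1(\Sigma)$ on complex vector spaces $E$ such that $\pi(\ell^1(\Sigma))E\neq\{0\}$ and the only invariant subspaces of $E$ are $\{0\}$ and $E$; it carries the hull-kernel topology, in which the closure of a set $\mathcal E$ of primitive ideals is $\{P : P\supseteq\bigcap_{Q\in\mathcal E}Q\}$. 1. If all orbits in $X$ have the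 same finite cardinality, then $\Pi_{\ell^1(\Sigma)}$ is homeomorphic to $(X/\mathbb Z)\times\mathbb T$. 2. Let $p,q$ be coprime integers with $q\neq0$, let $X=\mathbb T$, and let $\sigma$ be the rotation $z\mapsto e^{2\pi i p/q}z$. Then the orbit of each $z_0\in\mathbb T$ is $\{z\in\mathbb T : z^q=z_0^q\}$; the map $z\mapsto z^q$ induces a homeomorphism from $\mathbb T/\mathbb Z$ onto $\mathbb T$; and $\Pi_{\ell^1(\Sigma)}$ is homeomorphic to $(\mathbb T/\mathbb Z)\times\mathbb T$ and to $\mathbb T^2=\mathbb T\times\mathbb T$. -/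

import Mathlib

/-! ### Orbits of a homeomorphism -/

section Orbits

variable {X : Type*} [TopologicalSpace X]

/-- The orbit of `x` under the `ℤ`-action generated by the homeomorphism `σ`. -/
def dynOrbit (σ : X ≃ₜ X) (x : X) : Set X := Set.range fun n : ℤ => (σ ^ n) x

/-- Two points are equivalent if some integer power of `σ` maps one to the other. -/
def dynOrbitSetoid (σ : X ≃ₜ X) : Setoid X where
  r x y := ∃ n : ℤ, (σ ^ n) x = y
  iseqv :=
    { refl := fun x => ⟨0, rfl⟩
      symm := by
        rintro x y ⟨n, rfl⟩
        refine ⟨-n, ?_⟩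
        rw [← Homeomorph.mul_apply, ← zpow_add, neg_add_cancel, zpow_zero]
        rfl
      trans := by
        rintro x y z ⟨n, rfl⟩ ⟨m, rfl⟩
        exact ⟨m + n, by rw [zpow_add, Homeomorph.mul_apply]⟩ }

/-- The orbit space `X/ℤ`. -/
def OrbitSpace (σ : X ≃ₜ X) : Type _ := Quotient (dynOrbitSetoid σ)

/-- The orbit space carries the quotient topology. -/
instance (σ : X ≃ₜ X) : TopologicalSpace (OrbitSpace σ) :=
  inferInstanceAs (TopologicalSpace (Quotient (dynOrbitSetoid σ)))

/-- The quotient map `X → X/ℤ`. -/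
def OrbitSpace.mk (σ : X ≃ₜ X) (x : X) : OrbitSpace σ := Quotient.mk (dynOrbitSetoid σ) x

end Orbits

/-! ### The Banach algebra `ℓ¹(Σ)` of a topological dynamical system `Σ = (X, σ)` -/

section EllOne

variable {X : Type*} [TopologicalSpace X]

/-- The automorphism `α ^ k` of `C(X)`, that is `f ↦ f ∘ σ ^ (-k)`. -/
noncomputable def alphaPow (σ : X ≃ₜ X) (k : ℤ) : C(X, ℂ) →⋆ₐ[ℂ] C(X, ℂ) :=
  ContinuousMap.compStarAlgHom' ℂ ℂ ((σ ^ (-k) : X ≃ₜ X) : C(X, X))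

@[simp]
theorem alphaPow_apply (σ : X ≃ₜ X) (k : ℤ) (f : C(X, ℂ)) (x : X) :
    alphaPow σ k f x = f ((σ ^ (-k)) x) := rfl

theorem alphaPow_zero (σ : X ≃ₜ X) (f : C(X, ℂ)) : alphaPow σ 0 f = f := by
  ext x; simp

theorem alphaPow_alphaPow (σ : X ≃ₜ X) (k l : ℤ) (f : C(X, ℂ)) :
    alphaPow σ k (alphaPow σ l f) = alphaPow σ (k + l) f := by
  ext x
  simp only [alphaPow_apply, ← Homeomorph.mul_apply, ← zpow_add]
  rw [neg_add_rev]

theorem norm_alphaPow_le [CompactSpace X] (σ : X ≃ₜ X) (k : ℤ) (f : C(X, ℂ)) : ‖alphaPow σ k f‖ ≤ ‖f‖ :=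
  (ContinuousMap.norm_le _ (norm_nonneg _)).2 fun _ => f.norm_coe_le_norm _

theorem continuous_alphaPow (σ : X ≃ₜ X) (k : ℤ) : Continuous (alphaPow σ k) :=
  ContinuousMap.continuous_precomp _

variable [CompactSpace X]

/-- The space `ℓ¹(Σ) = ℓ¹(ℤ, C(X))` of all `a : ℤ → C(X)` with `‖a‖ = ∑ ‖a n‖ < ∞`. -/
def EllOne (_σ : X ≃ₜ X) : Type _ := lp (fun _ : ℤ => C(X, ℂ)) 1

namespace EllOne

variable {σ : X ≃ₜ X}

noncomputable instance : NormedAddCommGroup (EllOne σ) :=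
  inferInstanceAs (NormedAddCommGroup (lp (fun _ : ℤ => C(X, ℂ)) 1))

noncomputable instance : NormedSpace ℂ (EllOne σ) :=
  inferInstanceAs (NormedSpace ℂ (lp (fun _ : ℤ => C(X, ℂ)) 1))

instance : CompleteSpace (EllOne σ) :=
  inferInstanceAs (CompleteSpace (lp (fun _ : ℤ => C(X, ℂ)) 1))

/-- The `n`-th coefficient `a n ∈ C(X)` of `a ∈ ℓ¹(Σ)`. -/
def coeff (a : EllOne σ) (n : ℤ) : C(X, ℂ) := Subtype.val (α := PreLp fun _ : ℤ => C(X, ℂ)) a n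

theorem ext_coeff {a b : EllOne σ} (h : ∀ n, a.coeff n = b.coeff n) : a = b :=
  Subtype.ext (funext h)

theorem summable_norm (a : EllOne σ) : Summable fun n => ‖a.coeff n‖ := by
  have := (lp.hasSum_norm (p := 1) (by simp) (show lp (fun _ : ℤ => C(X, ℂ)) 1 from a)).summable
  simp only [ENNReal.toReal_one, Real.rpow_one] at this
  exact this

theorem norm_eq_tsum (a : EllOne σ) : ‖a‖ = ∑' n, ‖a.coeff n‖ := by
  have := lp.norm_eq_tsum_rpow (p := 1) (by simp) (show lp (fun _ : ℤ => C(X, ℂ)) 1 from a)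
  simp only [ENNReal.toReal_one, Real.rpow_one, div_one] at this
  exact this

/-- An element of `ℓ¹(Σ)` from its absolutely summable family of coefficients. -/
def ofCoeff (f : ℤ → C(X, ℂ)) (hf : Summable fun n => ‖f n‖) : EllOne σ :=
  (⟨f, memℓp_gen (by simpa using hf)⟩ : lp (fun _ : ℤ => C(X, ℂ)) 1)

@[simp] theorem coeff_ofCoeff (f : ℤ → C(X, ℂ)) (hf) (n : ℤ) :
    (ofCoeff f hf : EllOne σ).coeff n = f n := rfl
@[simp] theorem coeff_add (a b : EllOne σ) (n : ℤ) :
    (a + b).coeff n = a.coeff n + b.coeff n := rfl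
@[simp] theorem coeff_zero (n : ℤ) : (0 : EllOne σ).coeff n = 0 := rfl
@[simp] theorem coeff_smul (c : ℂ) (a : EllOne σ) (n : ℤ) :
    (c • a).coeff n = c • a.coeff n := rfl

/-- The `k`-th term `a k · α ^ k (b (n - k))` of the twisted convolution at `n`. -/
noncomputable def mulTerm (a b : EllOne σ) (n k : ℤ) : C(X, ℂ) :=
  a.coeff k * alphaPow σ k (b.coeff (n - k))

theorem norm_mulTerm_le (a b : EllOne σ) (n k : ℤ) :
    ‖mulTerm a b n k‖ ≤ ‖a.coeff k‖ * ‖b.coeff (n - k)‖ :=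
  (norm_mul_le _ _).trans (by gcongr; exact norm_alphaPow_le _ _ _)

theorem summable_majorant (a b : EllOne σ) :
    Summable fun q : ℤ × ℤ => ‖a.coeff q.2‖ * ‖b.coeff (q.1 - q.2)‖ := by
  have h := a.summable_norm.mul_of_nonneg b.summable_norm
    (fun _ => norm_nonneg _) (fun _ => norm_nonneg _)
  let e : ℤ × ℤ ≃ ℤ × ℤ :=
    { toFun := fun q => (q.2, q.1 - q.2)
      invFun := fun q => (q.1 + q.2, q.1)
      left_inv := fun q => by ext <;> simp
      right_inv := fun q => by ext <;> simp }
  exact (e.summable_iff (f := fun x : ℤ × ℤ => ‖a.coeff x.1‖ * ‖b.coeff x.2‖)).2 h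

theorem summable_norm_mulTerm (a b : EllOne σ) :
    Summable fun q : ℤ × ℤ => ‖mulTerm a b q.1 q.2‖ :=
  (summable_majorant a b).of_nonneg_of_le (fun _ => norm_nonneg _)
    fun _ => norm_mulTerm_le _ _ _ _

theorem summable_mulTerm (a b : EllOne σ) (n : ℤ) : Summable (mulTerm a b n) :=
  ((summable_norm_mulTerm a b).prod_factor n).of_norm

theorem summable_norm_mul (a b : EllOne σ) :
    Summable fun n => ‖∑' k, mulTerm a b n k‖ :=
  (summable_norm_mulTerm a b).prod.of_nonneg_of_le (fun _ => norm_nonneg _)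
    fun n => norm_tsum_le_tsum_norm ((summable_norm_mulTerm a b).prod_factor n)

/-- The twisted convolution `(a b) n = ∑ k, a k · α ^ k (b (n - k))`. -/
noncomputable instance : Mul (EllOne σ) where
  mul a b := ofCoeff (fun n => ∑' k, mulTerm a b n k) (summable_norm_mul a b)

theorem coeff_mul (a b : EllOne σ) (n : ℤ) :
    (a * b).coeff n = ∑' k, a.coeff k * alphaPow σ k (b.coeff (n - k)) := rfl

theorem hasSum_coeff_mul (a b : EllOne σ) (n : ℤ) :
    HasSum (mulTerm a b n) ((a * b).coeff n) := (summable_mulTerm a b n).hasSum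

/-- The identity element has coefficient `1` at `0`, and all other coefficients `0`. -/
noncomputable instance : One (EllOne σ) where
  one := ofCoeff (Pi.single 0 1) (by
    refine summable_of_ne_finset_zero (s := {0}) fun n hn => ?_
    rw [Pi.single_eq_of_ne (by simpa using hn), norm_zero])

theorem coeff_one (n : ℤ) : (1 : EllOne σ).coeff n = if n = 0 then 1 else 0 :=
  Pi.single_apply (0 : ℤ) (1 : C(X, ℂ)) n

protected theorem one_mul' (a : EllOne σ) : 1 * a = a := by
  refine ext_coeff fun n => ?_
  rw [coeff_mul, tsum_eq_single 0 fun k hk => by simp [coeff_one, hk]]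
  simp [coeff_one, alphaPow_zero]

protected theorem mul_one' (a : EllOne σ) : a * 1 = a := by
  refine ext_coeff fun n => ?_
  rw [coeff_mul, tsum_eq_single n fun k hk => by
    simp [coeff_one, sub_eq_zero, Ne.symm hk]]
  simp [coeff_one]

protected theorem mul_add' (a b c : EllOne σ) : a * (b + c) = a * b + a * c := by
  refine ext_coeff fun n => ?_
  rw [coeff_add]
  refine (hasSum_coeff_mul a (b + c) n).unique ?_
  refine ((hasSum_coeff_mul a b n).add (hasSum_coeff_mul a c n)).congr_fun fun k => ?_
  simp [mulTerm, mul_add]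

protected theorem add_mul' (a b c : EllOne σ) : (a + b) * c = a * c + b * c := by
  refine ext_coeff fun n => ?_
  rw [coeff_add]
  refine (hasSum_coeff_mul (a + b) c n).unique ?_
  refine ((hasSum_coeff_mul a c n).add (hasSum_coeff_mul b c n)).congr_fun fun k => ?_
  simp [mulTerm, add_mul]

protected theorem norm_mul_le' (a b : EllOne σ) : ‖a * b‖ ≤ ‖a‖ * ‖b‖ := by
  have hab := summable_majorant a b
  have h1 : ‖a * b‖ ≤ ∑' n, ∑' k, ‖a.coeff k‖ * ‖b.coeff (n - k)‖ := by
    rw [norm_eq_tsum]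
    refine (summable_norm_mul a b).tsum_le_tsum (fun n => ?_) hab.prod
    exact (norm_tsum_le_tsum_norm ((summable_norm_mulTerm a b).prod_factor n)).trans
      (((summable_norm_mulTerm a b).prod_factor n).tsum_le_tsum
        (fun k => norm_mulTerm_le a b n k) (hab.prod_factor n))
  refine h1.trans (le_of_eq ?_)
  rw [← Summable.tsum_comm (f := fun n k => ‖a.coeff k‖ * ‖b.coeff (n - k)‖) hab,
    norm_eq_tsum a, ← tsum_mul_right]
  refine tsum_congr fun k => ?_
  rw [tsum_mul_left, norm_eq_tsum b]
  exact congrArg _ ((Equiv.subRight k).tsum_eq fun n => ‖b.coeff n‖)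

protected theorem mul_assoc' (a b c : EllOne σ) : a * b * c = a * (b * c) := by
  refine ext_coeff fun n => ?_
  let F : ℤ × ℤ → C(X, ℂ) := fun q =>
    a.coeff q.2 * alphaPow σ q.2 (b.coeff (q.1 - q.2)) * alphaPow σ q.1 (c.coeff (n - q.1))
  have hF : Summable F := by
    refine Summable.of_norm_bounded (g := fun q => ‖mulTerm a b q.1 q.2‖ * ‖c‖)
      ((summable_norm_mulTerm a b).mul_right _) fun q => ?_
    refine (norm_mul_le _ _).trans ?_
    refine mul_le_mul_of_nonneg_left ((norm_alphaPow_le _ _ _).trans ?_) (norm_nonneg _)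
    rw [norm_eq_tsum]
    exact c.summable_norm.le_tsum _ fun _ _ => norm_nonneg _
  have hl : (a * b * c).coeff n = ∑' m, ∑' k, F (m, k) := by
    rw [coeff_mul]
    refine tsum_congr fun m => ?_
    exact ((hasSum_coeff_mul a b m).mul_right _).tsum_eq.symm
  have hr : (a * (b * c)).coeff n = ∑' k, ∑' m, F (m, k) := by
    rw [coeff_mul]
    refine tsum_congr fun k => ?_
    have h := ((hasSum_coeff_mul b c (n - k)).map (alphaPow σ k)
      (continuous_alphaPow σ k)).mul_left (a.coeff k)
    rw [← h.tsum_eq, ← (Equiv.subRight k).tsum_eq]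
    refine tsum_congr fun m => ?_
    simp [F, mulTerm, alphaPow_alphaPow, mul_assoc]
  rw [hl, hr]
  exact Summable.tsum_comm (f := fun m k => F (m, k)) hF |>.symm

noncomputable instance : NormedRing (EllOne σ) :=
  { (inferInstance : NormedAddCommGroup (EllOne σ)),
    (inferInstance : Mul (EllOne σ)), (inferInstance : One (EllOne σ)) with
    mul_assoc := EllOne.mul_assoc'
    one_mul := EllOne.one_mul'
    mul_one := EllOne.mul_one'
    left_distrib := EllOne.mul_add'
    right_distrib := EllOne.add_mul'
    zero_mul := fun a => by
      have h := EllOne.add_mul' 0 0 a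
      rwa [add_zero, left_eq_add] at h
    mul_zero := fun a => by
      have h := EllOne.mul_add' a 0 0
      rwa [add_zero, left_eq_add] at h
    norm_mul_le := EllOne.norm_mul_le' }

protected theorem smul_mul' (r : ℂ) (a b : EllOne σ) : r • a * b = r • (a * b) := by
  refine ext_coeff fun n => ?_
  rw [coeff_smul]
  refine (hasSum_coeff_mul (r • a) b n).unique ?_
  refine ((hasSum_coeff_mul a b n).const_smul r).congr_fun fun k => ?_
  simp [mulTerm]

protected theorem mul_smul' (r : ℂ) (a b : EllOne σ) : a * r • b = r • (a * b) := by
  refine ext_coeff fun n => ?_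
  rw [coeff_smul]
  refine (hasSum_coeff_mul a (r • b) n).unique ?_
  refine ((hasSum_coeff_mul a b n).const_smul r).congr_fun fun k => ?_
  simp [mulTerm]

/-- `ℓ¹(Σ)` is a unital complex Banach algebra. -/
noncomputable instance : NormedAlgebra ℂ (EllOne σ) :=
  { Algebra.ofModule (R := ℂ) (A := EllOne σ) EllOne.smul_mul' EllOne.mul_smul' with
    norm_smul_le := fun r a => norm_smul_le r a }

end EllOne

end EllOne

/-! ### Primitive ideals and the structure space -/

section Primitive

universe u

variable {A : Type u} [NonUnitalRing A] [Module ℂ A]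

/-- A representation `π` of `A` on a complex vector space `E` is algebraically irreducible if
`π(A)E ≠ {0}` and the only invariant subspaces of `E` are `{0}` and `E`. -/
structure IsAlgIrreducible {E : Type*} [AddCommGroup E] [Module ℂ E]
    (π : A →ₙₐ[ℂ] Module.End ℂ E) : Prop where
  nonzero : ∃ (a : A) (v : E), π a v ≠ 0
  eq_bot_or_top : ∀ W : Submodule ℂ E, (∀ a : A, ∀ w ∈ W, π a w ∈ W) → W = ⊥ ∨ W = ⊤

/-- A primitive ideal is the kernel of an algebraically irreducible representation. The universe
of the representation space is no restriction: `E` is linearly isomorphic to a quotient of `A`. -/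
def IsPrimitiveIdeal (P : TwoSidedIdeal A) : Prop :=
  ∃ (E : Type u) (_ : AddCommGroup E) (_ : Module ℂ E) (π : A →ₙₐ[ℂ] Module.End ℂ E),
    IsAlgIrreducible π ∧ P = TwoSidedIdeal.ker π

theorem IsAlgIrreducible.exists_ne_zero {E : Type*} [AddCommGroup E] [Module ℂ E]
    {π : A →ₙₐ[ℂ] Module.End ℂ E} (h : IsAlgIrreducible π) {a b : A} (ha : π a ≠ 0)
    (hb : π b ≠ 0) : ∃ c, π (a * c * b) ≠ 0 := by
  obtain ⟨v, hv⟩ : ∃ v, π b v ≠ 0 := by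
    by_contra! hc
    exact hb (LinearMap.ext hc)
  by_contra! hc
  have hc' : ∀ c, π a (π c (π b v)) = 0 := fun c => by
    have := LinearMap.congr_fun (hc c) v
    simpa [map_mul] using this
  let N : Submodule ℂ E :=
    { carrier := {w | ∀ c, π c w = 0}
      add_mem' := fun {x y} hx hy c => by rw [map_add, hx c, hy c, add_zero]
      zero_mem' := fun c => map_zero _
      smul_mem' := fun r x hx c => by rw [map_smul, hx c, smul_zero] }
  have hN : N = ⊥ := by
    refine (h.eq_bot_or_top N fun c w hw d => by rw [hw c, map_zero]).resolve_right ?_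
    intro ht
    obtain ⟨c, w, hw⟩ := h.nonzero
    have : w ∈ N := ht ▸ Submodule.mem_top
    exact hw (this c)
  let W : Submodule ℂ E :=
    { carrier := {w | ∃ c, π c (π b v) = w}
      add_mem' := by
        rintro _ _ ⟨c, rfl⟩ ⟨d, rfl⟩
        exact ⟨c + d, by rw [map_add]; rfl⟩
      zero_mem' := ⟨0, by rw [map_zero]; rfl⟩
      smul_mem' := by
        rintro r _ ⟨c, rfl⟩
        exact ⟨r • c, by rw [map_smul]; rfl⟩ }
  rcases h.eq_bot_or_top W (by
    rintro d _ ⟨c, rfl⟩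
    exact ⟨d * c, by rw [map_mul]; rfl⟩) with hW | hW
  · refine hv ?_
    have : π b v ∈ N := fun c => by
      have : π c (π b v) ∈ W := ⟨c, rfl⟩
      rw [hW] at this
      exact (Submodule.mem_bot ℂ).1 this
    rw [hN] at this
    exact (Submodule.mem_bot ℂ).1 this
  · refine ha (LinearMap.ext fun w => ?_)
    have : w ∈ W := hW ▸ Submodule.mem_top
    obtain ⟨c, rfl⟩ := this
    exact hc' c

theorem IsPrimitiveIdeal.mem_or_mem {P : TwoSidedIdeal A} (hP : IsPrimitiveIdeal P) {a b : A}
    (h : ∀ c, a * c * b ∈ P) : a ∈ P ∨ b ∈ P := by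
  obtain ⟨E, _, _, π, hπ, rfl⟩ := hP
  simp only [TwoSidedIdeal.mem_ker] at h ⊢
  by_contra! hc
  obtain ⟨c, hc⟩ := hπ.exists_ne_zero hc.1 hc.2
  exact hc (h c)

variable (A) in
/-- The set of all primitive ideals of `A`; with the topology below, the structure space of `A`. -/
def StructureSpace : Type u := {P : TwoSidedIdeal A // IsPrimitiveIdeal P}

/-- The hull of a subset `S` of `A`: all primitive ideals that contain `S`. -/
def primHull (S : Set A) : Set (StructureSpace A) := {P | ∀ a ∈ S, a ∈ P.1}

/-- The kernel of a set of primitive ideals: their intersection. -/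
def primKernel (E : Set (StructureSpace A)) : Set A := {a | ∀ P ∈ E, a ∈ P.1}

theorem subset_primHull_primKernel (E : Set (StructureSpace A)) : E ⊆ primHull (primKernel E) :=
  fun P hP _ ha => ha P hP

/-- The hull-kernel topology on the set of primitive ideals: a set `E` of primitive ideals is
closed if and only if it is equal to the hull of its kernel. -/
instance : TopologicalSpace (StructureSpace A) :=
  TopologicalSpace.ofClosed {E | primHull (primKernel E) = E}
    (by
      refine Set.eq_empty_of_forall_notMem fun P hP => ?_
      obtain ⟨E, _, _, π, hπ, hk⟩ := P.2
      obtain ⟨a, v, hav⟩ := hπ.nonzero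
      have ha : a ∈ P.1 := hP a fun Q hQ => hQ.elim
      rw [hk, TwoSidedIdeal.mem_ker] at ha
      exact hav (by rw [ha]; rfl))
    (by
      intro T hT
      refine Set.Subset.antisymm (fun P hP E hE => ?_) (subset_primHull_primKernel _)
      rw [← hT hE]
      exact fun a ha => hP a fun Q hQ => ha Q (hQ E hE))
    (by
      intro E hE F hF
      refine Set.Subset.antisymm (fun P hP => ?_) (subset_primHull_primKernel _)
      by_contra hc
      have hPE : P ∉ primHull (primKernel E) := fun h => hc (Or.inl (hE ▸ h))
      have hPF : P ∉ primHull (primKernel F) := fun h => hc (Or.inr (hF ▸ h))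
      simp only [primHull, Set.mem_ofPred_eq, not_forall] at hPE hPF
      obtain ⟨a, ha, haP⟩ := hPE
      obtain ⟨b, hb, hbP⟩ := hPF
      refine (P.2.mem_or_mem fun c => hP (a * c * b) ?_).elim haP hbP
      rintro Q (hQ | hQ)
      · exact Q.1.mul_mem_right _ _ (Q.1.mul_mem_right _ _ (ha Q hQ))
      · exact Q.1.mul_mem_left _ _ (hb Q hQ))

theorem StructureSpace.isClosed_iff {E : Set (StructureSpace A)} :
    IsClosed E ↔ primHull (primKernel E) = E := by
  rw [← isOpen_compl_iff]
  change Eᶜᶜ ∈ {E : Set (StructureSpace A) | primHull (primKernel E) = E} ↔ _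
  rw [compl_compl]
  rfl

/-- The closure in the hull-kernel topology is the hull of the kernel. -/
theorem StructureSpace.closure_eq (E : Set (StructureSpace A)) :
    closure E = primHull (primKernel E) := by
  refine Set.Subset.antisymm (closure_minimal (subset_primHull_primKernel E) ?_) ?_
  · rw [StructureSpace.isClosed_iff]
    refine Set.Subset.antisymm (fun P hP a ha => hP a fun Q hQ => hQ a ha)
      (subset_primHull_primKernel _)
  · rw [← StructureSpace.isClosed_iff.1 (isClosed_closure (s := E))]
    exact fun P hP a ha => hP a fun Q hQ => ha Q (subset_closure hQ)

end Primitive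

/-! ### Rotations of the unit circle -/

/-- The rotation `z ↦ exp (2 π i p / q) z` of the unit circle. -/
noncomputable def ratRotation (p q : ℤ) : Circle ≃ₜ Circle :=
  Homeomorph.mulLeft (Circle.exp (2 * Real.pi * ((p : ℝ) / (q : ℝ))))

/-! ### Algebraically irreducible representations of unital Banach algebras -/

namespace IsAlgIrreducible

section Algebraic

variable {A : Type*} [Ring A] [Algebra ℂ A] {E : Type*} [AddCommGroup E] [Module ℂ E]
  {π : A →ₙₐ[ℂ] Module.End ℂ E}

/-! Write `δ ^ k` for `single σ k 1`. If every orbit has `p` points, then `σ ^ p = 1`, so `δ ^ p`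
and all `σ`-invariant functions are central. In an irreducible representation central elements act
by scalars (`exists_map_eq_smul`): for `v ≠ 0` the annihilator `M` of `v` is closed, `E` is `A ⧸ M`,
and Schur's lemma applies to any point of the spectrum of the operator induced on this Banach space.

Hence `δ ^ p` acts by some `z` in the circle, and the scalar action of invariant functions forces
`C(X)` to act through a single orbit. Modulo the kernel, `a` becomes `∑ j < p, f_j δ ^ j` with `f_j
= fiberCoeff p z j a`, and the kernel consists of those `a` for which all `f_j` vanish on the orbit
(`exists_map_eq_zero_iff`). Conversely, each pair of an orbit and a scalar is realised on a
`p`-dimensional space of sequences (`rep`).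

The bijection with pairs respects closures (`orbitPrimIdeal_mem_closure_image_iff`). Since
`fiberCoeff` is jointly continuous in point and scalar, membership in the ideals is a closed
condition. Separation is provided by `F · g(δ ^ p)`, with `F` an invariant bump and `g` an
absolutely convergent Fourier series supported near a point.

For rational rotations, `z ↦ z ^ q` identifies the orbit space with the circle. -/

theorem map_one (h : IsAlgIrreducible π) : π 1 = 1 := by
  obtain ⟨a, v, hav⟩ := h.nonzero
  -- `π` is not assumed unital. The vectors fixed by `π 1` contain `π(A)E`, hence form a non-zero
  -- invariant subspace.
  rcases h.eq_bot_or_top (LinearMap.eqLocus (π 1) 1) (fun b w _ => by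
    change π 1 (π b w) = π b w
    rw [← Module.End.mul_apply, ← map_mul, one_mul]) with hW | hW
  · refine absurd ((Submodule.mem_bot ℂ).1 (hW ▸ (?_ : π a v ∈ LinearMap.eqLocus (π 1) 1))) hav
    change π 1 (π a v) = π a v
    rw [← Module.End.mul_apply, ← map_mul, one_mul]
  · exact LinearMap.ext fun w => (hW ▸ Submodule.mem_top : w ∈ LinearMap.eqLocus (π 1) 1)

theorem exists_vec_ne_zero (h : IsAlgIrreducible π) : ∃ v : E, v ≠ 0 := by
  obtain ⟨a, v, hav⟩ := h.nonzero
  exact ⟨_, hav⟩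

theorem map_ne_zero_of_isUnit (h : IsAlgIrreducible π) {a : A} (ha : IsUnit a) : π a ≠ 0 := by
  intro h0
  obtain ⟨v, hv⟩ := h.exists_vec_ne_zero
  obtain ⟨u, rfl⟩ := ha
  have : π ((u⁻¹ : Aˣ) * u) = 0 := by rw [map_mul, h0, mul_zero]
  rw [Units.inv_mul, h.map_one] at this
  exact hv (LinearMap.congr_fun this v)

/-- Every non-zero vector is cyclic. -/
theorem exists_map_eq (h : IsAlgIrreducible π) {v : E} (hv : v ≠ 0) (w : E) :
    ∃ a, π a v = w := by
  let W : Submodule ℂ E := LinearMap.range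
    ((LinearMap.applyₗ v).comp (π : A →ₗ[ℂ] Module.End ℂ E))
  have hW : W = ⊤ := by
    refine (h.eq_bot_or_top W ?_).resolve_left fun hb => hv ?_
    · rintro a _ ⟨b, rfl⟩
      exact ⟨a * b, by simp⟩
    · refine (Submodule.mem_bot ℂ).1 (hb ▸ (⟨1, ?_⟩ : v ∈ W))
      simp [h.map_one]
  obtain ⟨a, ha⟩ := (hW ▸ Submodule.mem_top : w ∈ W)
  exact ⟨a, ha⟩

/-- **Schur's lemma**: an intertwining operator is zero or bijective. -/
theorem eq_zero_or_bijective (h : IsAlgIrreducible π) {T : Module.End ℂ E}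
    (hT : ∀ a, Commute T (π a)) : T = 0 ∨ Function.Bijective T := by
  have hT' : ∀ a v, T (π a v) = π a (T v) := fun a v => LinearMap.congr_fun (hT a) v
  rcases h.eq_bot_or_top (LinearMap.ker T) (fun a w hw => by
    rw [LinearMap.mem_ker] at hw ⊢
    rw [hT', hw, map_zero]) with hk | hk
  · rcases h.eq_bot_or_top (LinearMap.range T) (by
      rintro a _ ⟨w, rfl⟩
      exact ⟨π a w, hT' a w⟩) with hr | hr
    · exact Or.inl (LinearMap.range_eq_bot.1 hr)
    · exact Or.inr ⟨LinearMap.ker_eq_bot.1 hk, LinearMap.range_eq_top.1 hr⟩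
  · exact Or.inl (LinearMap.ker_eq_top.1 hk)

end Algebraic

section Banach

variable {A : Type*} [NormedRing A] [NormedAlgebra ℂ A] {E : Type*} [AddCommGroup E]
  [Module ℂ E] {π : A →ₙₐ[ℂ] Module.End ℂ E}

variable (π) in
/-- The left annihilator of a vector. -/
noncomputable def annihilator (v : E) : Submodule ℂ A :=
  LinearMap.ker ((LinearMap.applyₗ v).comp (π : A →ₗ[ℂ] Module.End ℂ E))

theorem mem_annihilator {v : E} {a : A} : a ∈ annihilator π v ↔ π a v = 0 := Iff.rfl

variable [CompleteSpace A]

/-- No norm on `E` is needed. If `a` lies in the closure but `π a v ≠ 0`, cyclicity gives `b` with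
`π (b * a) v = v`. Then `1 - b * a` annihilates `v`, so `1` lies in the closure. As units form an
open set, some unit annihilates `v`, which forces `v = 0`. -/
theorem isClosed_annihilator (h : IsAlgIrreducible π) (v : E) :
    IsClosed (annihilator π v : Set A) := by
  by_cases hv : v = 0
  · convert isClosed_univ
    ext a
    simp [mem_annihilator, hv]
  refine isClosed_of_closure_subset fun a ha => ?_
  by_contra hav
  obtain ⟨b, hb⟩ : ∃ b, π b (π a v) = v := h.exists_map_eq hav v
  have h1 : (1 - b * a) ∈ annihilator π v := by
    rw [mem_annihilator, map_sub, map_mul, h.map_one, LinearMap.sub_apply, Module.End.mul_apply,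
      hb]
    exact sub_self v
  have h2 : (1 : A) ∈ closure (annihilator π v : Set A) := by
    have hba : b * a ∈ closure (annihilator π v : Set A) :=
      map_mem_closure (continuous_const_mul b) ha fun c hc => by
        rw [SetLike.mem_coe, mem_annihilator] at hc ⊢
        rw [map_mul, Module.End.mul_apply, hc, map_zero]
    have := (annihilator π v).topologicalClosure.add_mem (subset_closure h1) hba
    rwa [sub_add_cancel] at this
  obtain ⟨u, hu, huu⟩ := mem_closure_iff.1 h2 _ Units.isOpen isUnit_one
  obtain ⟨u, rfl⟩ := hu
  have : π ((u⁻¹ : Aˣ) * u) v = 0 := by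
    rw [map_mul, Module.End.mul_apply, mem_annihilator.1 huu, map_zero]
  rw [Units.inv_mul, h.map_one] at this
  exact hv this

theorem isClosed_ker (h : IsAlgIrreducible π) : IsClosed {a : A | π a = 0} := by
  have : {a : A | π a = 0} = ⋂ v : E, (annihilator π v : Set A) := by
    ext a
    simp only [Set.mem_iInter, SetLike.mem_coe, mem_annihilator]
    exact LinearMap.ext_iff
  rw [this]
  exact isClosed_iInter h.isClosed_annihilator

/-- Central elements act by scalars. -/
theorem exists_map_eq_smul (h : IsAlgIrreducible π) {z : A} (hz : ∀ a, Commute z a) :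
    ∃ c : ℂ, π z = c • 1 := by
  obtain ⟨v, hv⟩ := h.exists_vec_ne_zero
  let M := annihilator π v
  have : IsClosed (M : Set A) := h.isClosed_annihilator v
  have hM1 : (1 : A) ∉ M := fun h1 => hv (by
    have := mem_annihilator.1 h1
    rwa [h.map_one] at this)
  have : Nontrivial (A ⧸ M) := ⟨M.mkQ 1, 0, fun h0 => hM1 ((Submodule.Quotient.mk_eq_zero M).1 h0)⟩
  have hle : M ≤ (M.mkQL.comp (ContinuousLinearMap.mul ℂ A z)).ker := fun a ha => by
    change M.mkQ (z * a) = 0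
    rw [Submodule.mkQ_apply, Submodule.Quotient.mk_eq_zero, mem_annihilator, map_mul,
      Module.End.mul_apply, mem_annihilator.1 ha, map_zero]
  -- Under `a ↦ π a v` the Banach space `A ⧸ M` is identified with `E`, and `T` corresponds to `π
  -- z`. For `c` in the spectrum of `T`, the intertwiner `c • 1 - π z` cannot be bijective, so
  -- Schur's lemma makes it zero.
  let T : (A ⧸ M) →L[ℂ] (A ⧸ M) := M.liftQL (M.mkQL.comp (ContinuousLinearMap.mul ℂ A z)) hle
  have hT : ∀ a, T (M.mkQ a) = M.mkQ (z * a) := fun a => rfl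
  obtain ⟨c, hc⟩ := spectrum.nonempty T
  refine ⟨c, ?_⟩
  have hS := h.eq_zero_or_bijective (T := c • 1 - π z) fun a => by
    refine ((Commute.one_left _).smul_left c).sub_left ?_
    change π z * π a = π a * π z
    rw [← map_mul, ← map_mul, hz a]
  rcases hS with hS | hS
  · exact (sub_eq_zero.1 hS).symm
  · refine absurd ?_ (spectrum.mem_iff.1 hc)
    rw [ContinuousLinearMap.isUnit_iff_bijective]
    have hTc : ∀ a, (algebraMap ℂ _ c - T) (M.mkQ a) = M.mkQ (c • a - z * a) := fun a => by
      rw [sub_apply, hT, Algebra.algebraMap_eq_smul_one, map_sub, map_smul]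
      rfl
    have hπ : ∀ a, π (c • a - z * a) v = (c • 1 - π z) (π a v) := fun a => by
      simp
    constructor
    · rw [injective_iff_map_eq_zero]
      intro y hy
      obtain ⟨a, rfl⟩ := M.mkQ_surjective y
      rw [hTc, Submodule.mkQ_apply, Submodule.Quotient.mk_eq_zero, mem_annihilator, hπ] at hy
      rw [Submodule.mkQ_apply, Submodule.Quotient.mk_eq_zero, mem_annihilator]
      exact hS.1 (hy.trans (map_zero _).symm)
    · intro y
      obtain ⟨b, rfl⟩ := M.mkQ_surjective y
      obtain ⟨w, hw⟩ := hS.2 (π b v)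
      obtain ⟨a, rfl⟩ := h.exists_map_eq hv w
      refine ⟨M.mkQ a, ?_⟩
      rw [hTc, ← sub_eq_zero, ← map_sub, Submodule.mkQ_apply, Submodule.Quotient.mk_eq_zero,
        mem_annihilator, map_sub, LinearMap.sub_apply, hπ, hw, sub_self]

/-- The element `c • 1 - z` is in the kernel, hence not a unit, so `c` belongs to the spectrum of
`z`. -/
theorem norm_le_of_map_eq_smul [NormOneClass A] (h : IsAlgIrreducible π) {z : A} {c : ℂ}
    (hc : π z = c • 1) : ‖c‖ ≤ ‖z‖ := by
  refine spectrum.norm_le_norm_of_mem (𝕜 := ℂ) (spectrum.mem_iff.2 fun hu => ?_)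
  refine h.map_ne_zero_of_isUnit hu ?_
  rw [Algebra.algebraMap_eq_smul_one, map_sub, map_smul, h.map_one, hc, sub_self]

end Banach

end IsAlgIrreducible

/-! ### Homeomorphisms all of whose orbits have the same finite cardinality -/

section Periodic

variable {X : Type*} [TopologicalSpace X]

theorem zpow_apply_eq_self_iff_of_encard {σ : X ≃ₜ X} {p : ℕ} {x : X}
    (h : (dynOrbit σ x).encard = p) (n : ℤ) : (σ ^ n) x = x ↔ (p : ℤ) ∣ n := by
  let _ : MulAction (X ≃ₜ X) X :=
    { smul := fun g y => g y
      one_smul := fun _ => rfl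
      mul_smul := fun _ _ _ => rfl }
  have ho : dynOrbit σ x = MulAction.orbit (Subgroup.zpowers σ) x := by
    ext y
    constructor
    · rintro ⟨n, rfl⟩
      exact ⟨⟨σ ^ n, n, rfl⟩, rfl⟩
    · rintro ⟨⟨_, n, rfl⟩, rfl⟩
      exact ⟨n, rfl⟩
  have hm : Function.minimalPeriod (fun y : X => σ • y) x = p := by
    have hc : ENat.card (ZMod (Function.minimalPeriod (fun y : X => σ • y) x)) = p := by
      rw [← h, ho, Set.encard]
      exact ENat.card_congr (MulAction.orbitZPowersEquiv σ x).symm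
    -- Minimal period `0` encodes an aperiodic point, whose orbit is a copy of `ZMod 0 = ℤ` and
    -- therefore infinite.
    rcases Nat.eq_zero_or_pos (Function.minimalPeriod (fun y : X => σ • y) x) with h0 | h0
    · rw [h0] at hc
      rw [ENat.card_eq_top_of_infinite (α := ZMod 0)] at hc
      exact absurd hc (by simp)
    · have : NeZero (Function.minimalPeriod (fun y : X => σ • y) x) := ⟨h0.ne'⟩
      rw [ENat.card_eq_coe_fintype_card, ZMod.card] at hc
      exact_mod_cast hc
  rw [← hm]
  exact MulAction.zpow_smul_eq_iff_minimalPeriod_dvd (a := σ) (b := x)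

/-- All points have exact period `p`, where `p > 0`. -/
structure HasExactPeriod (σ : X ≃ₜ X) (p : ℕ) : Prop where
  pos : 0 < p
  zpow_apply_eq_self_iff : ∀ (x : X) (n : ℤ), (σ ^ n) x = x ↔ (p : ℤ) ∣ n

theorem HasExactPeriod.of_encard [Nonempty X] {σ : X ≃ₜ X} {p : ℕ}
    (h : ∀ x, (dynOrbit σ x).encard = p) : HasExactPeriod σ p where
  pos := by
    obtain ⟨x⟩ := ‹Nonempty X›
    rw [Nat.pos_iff_ne_zero]
    rintro rfl
    have := h x
    rw [Nat.cast_zero, Set.encard_eq_zero] at this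
    exact Set.notMem_empty x (this ▸ ⟨0, rfl⟩)
  zpow_apply_eq_self_iff x n := zpow_apply_eq_self_iff_of_encard (h x) n

theorem Homeomorph.zpow_add_apply (σ : X ≃ₜ X) (m n : ℤ) (x : X) :
    (σ ^ (m + n)) x = (σ ^ m) ((σ ^ n) x) := by
  rw [zpow_add, Homeomorph.mul_apply]

namespace HasExactPeriod

variable {σ : X ≃ₜ X} {p : ℕ}

theorem zpow_mul_apply (h : HasExactPeriod σ p) (m : ℤ) (x : X) : (σ ^ ((p : ℤ) * m)) x = x :=
  (h.zpow_apply_eq_self_iff x _).2 (dvd_mul_right _ _)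

/-- Every residue class modulo `p` is represented by exactly one `i < p`. -/
theorem exists_natCast_add (h : HasExactPeriod σ p) (n : ℤ) :
    ∃ i ∈ Finset.range p, ∃ m : ℤ, n = (i : ℤ) + p * m := by
  have hp : (0 : ℤ) < p := by exact_mod_cast h.pos
  refine ⟨(n % p).toNat, ?_, n / p, ?_⟩
  · rw [Finset.mem_range]
    have := Int.emod_lt_of_pos n hp
    have := Int.emod_nonneg n hp.ne'
    omega
  · rw [Int.toNat_of_nonneg (Int.emod_nonneg n hp.ne'), Int.emod_add_mul_ediv]

end HasExactPeriod

theorem eq_of_dvd_natCast_sub {p i j : ℕ} (hi : i < p) (hj : j < p)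
    (h : (p : ℤ) ∣ (i : ℤ) - j) : i = j := by
  have := Int.eq_zero_of_abs_lt_dvd h (by rw [abs_lt]; omega)
  omega

end Periodic

/-! ### Sums over orbits -/

section OrbitSum

variable {X : Type*} [TopologicalSpace X] {σ : X ≃ₜ X}

/-- The sum of a function over the translates by `σ ^ i` with `i < p`. -/
noncomputable def orbitSum (σ : X ≃ₜ X) (p : ℕ) (f : C(X, ℂ)) : C(X, ℂ) :=
  ∑ i ∈ Finset.range p, alphaPow σ i f

theorem orbitSum_apply (p : ℕ) (f : C(X, ℂ)) (x : X) :
    orbitSum σ p f x = ∑ i ∈ Finset.range p, f ((σ ^ (-(i : ℤ))) x) := by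
  simp [orbitSum, ContinuousMap.sum_apply]

theorem alphaPow_eq_self_of_alphaPow_one {f : C(X, ℂ)} (hf : alphaPow σ 1 f = f) (n : ℤ) :
    alphaPow σ n f = f := by
  induction n using Int.induction_on with
  | zero => exact alphaPow_zero σ f
  | succ n ih => rw [← alphaPow_alphaPow, hf, ih]
  | pred n ih =>
    conv_lhs => rw [← hf]
    rw [alphaPow_alphaPow, sub_add_cancel, ih]

/-- Since `α ^ p = 1`, applying `α` permutes the `p` summands cyclically. -/
theorem alphaPow_orbitSum {p : ℕ} (hσ : HasExactPeriod σ p) (f : C(X, ℂ)) (n : ℤ) :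
    alphaPow σ n (orbitSum σ p f) = orbitSum σ p f := by
  refine alphaPow_eq_self_of_alphaPow_one ?_ n
  have hp : alphaPow σ p f = alphaPow σ (0 : ℕ) f := by
    ext x
    have := hσ.zpow_mul_apply (-1) x
    rw [mul_neg_one] at this
    rw [alphaPow_apply, this, Nat.cast_zero, alphaPow_zero]
  have h : ∑ i ∈ Finset.range p, alphaPow σ ((i + 1 : ℕ) : ℤ) f = orbitSum σ p f :=
    add_right_cancel (b := alphaPow σ (0 : ℕ) f) <| by
      rw [← Finset.sum_range_succ' (fun i : ℕ => alphaPow σ (i : ℤ) f), Finset.sum_range_succ, hp,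
        orbitSum]
  conv_rhs => rw [← h]
  rw [orbitSum, map_sum]
  refine Finset.sum_congr rfl fun i _ => ?_
  rw [alphaPow_alphaPow, Nat.cast_succ, add_comm]

end OrbitSum

/-! ### Elements of `ℓ¹(Σ)` -/

namespace EllOne

variable {X : Type*} [TopologicalSpace X] [CompactSpace X] {σ : X ≃ₜ X}

instance [Nonempty X] : NormOneClass (EllOne σ) where
  norm_one := by
    rw [norm_eq_tsum, tsum_eq_single 0 fun n hn => by simp [coeff_one, hn]]
    simp [coeff_one]

theorem summable_norm_piSingle (k : ℤ) (f : C(X, ℂ)) :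
    Summable fun n => ‖(Pi.single k f : ℤ → C(X, ℂ)) n‖ :=
  summable_of_ne_finset_zero (s := {k}) fun n hn => by
    rw [Pi.single_eq_of_ne (by simpa using hn), norm_zero]

variable (σ) in
/-- The element `f δ ^ k` of `ℓ¹(Σ)`, whose only non-zero coefficient is `f` at `k`. -/
noncomputable def single (k : ℤ) : C(X, ℂ) →L[ℂ] EllOne σ :=
  LinearMap.mkContinuous
    { toFun := fun f => ofCoeff (Pi.single k f) (summable_norm_piSingle k f)
      map_add' := fun f g => ext_coeff fun n => by simp [Pi.single_add]
      map_smul' := fun c f => ext_coeff fun n => by simp [Pi.single_smul] } 1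
    fun f => by
      rw [norm_eq_tsum, one_mul, tsum_eq_single k fun n hn => by simp [Pi.single_eq_of_ne hn]]
      simp

theorem coeff_single (k : ℤ) (f : C(X, ℂ)) (n : ℤ) :
    (single σ k f).coeff n = if n = k then f else 0 := Pi.single_apply k f n

@[simp]
theorem coeff_single_same (k : ℤ) (f : C(X, ℂ)) : (single σ k f).coeff k = f := by
  simp [coeff_single]

theorem single_zero_one : single σ 0 1 = 1 :=
  ext_coeff fun n => by rw [coeff_single, coeff_one]

theorem coeff_single_mul (k : ℤ) (f : C(X, ℂ)) (a : EllOne σ) (n : ℤ) :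
    (single σ k f * a).coeff n = f * alphaPow σ k (a.coeff (n - k)) := by
  rw [coeff_mul, tsum_eq_single k fun m hm => by simp [coeff_single, hm], coeff_single_same]

theorem coeff_mul_single (k : ℤ) (f : C(X, ℂ)) (a : EllOne σ) (n : ℤ) :
    (a * single σ k f).coeff n = a.coeff (n - k) * alphaPow σ (n - k) f := by
  rw [coeff_mul, tsum_eq_single (n - k) fun m hm => by
    rw [coeff_single, if_neg (by omega), map_zero, mul_zero]]
  rw [sub_sub_cancel, coeff_single_same]

theorem single_mul_single (k l : ℤ) (f g : C(X, ℂ)) :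
    single σ k f * single σ l g = single σ (k + l) (f * alphaPow σ k g) := by
  refine ext_coeff fun n => ?_
  rw [coeff_single_mul, coeff_single, coeff_single]
  by_cases h : n = k + l
  · rw [if_pos (by omega), if_pos h]
  · rw [if_neg (by omega), if_neg h, map_zero, mul_zero]

theorem single_mul_single_one (k l : ℤ) (f : C(X, ℂ)) :
    single σ k f * single σ l 1 = single σ (k + l) f := by
  rw [single_mul_single, map_one, mul_one]

theorem single_zero_mul_single (k : ℤ) (f g : C(X, ℂ)) :
    single σ 0 f * single σ k g = single σ k (f * g) := by
  rw [single_mul_single, alphaPow_zero, zero_add]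

theorem hasSum_single (a : EllOne σ) : HasSum (fun k => single σ k (a.coeff k)) a := by
  have h := lp.hasSum_single (p := 1) (by simp) (show lp (fun _ : ℤ => C(X, ℂ)) 1 from a)
  refine HasSum.congr_fun h fun k => ?_
  refine ext_coeff fun n => ?_
  rw [coeff_single]
  exact (Pi.single_apply k _ n).symm

/-- An element of `ℓ¹(Σ)` with coefficients that are invariant under `σ` and supported on
multiples of the period is central. -/
theorem commute_of_forall_alphaPow_eq {p : ℕ} (hσ : HasExactPeriod σ p) {k : ℤ}
    (hk : (p : ℤ) ∣ k) {f : C(X, ℂ)} (hf : ∀ n, alphaPow σ n f = f) (a : EllOne σ) :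
    Commute (single σ k f) a := by
  refine ext_coeff fun n => ?_
  rw [coeff_single_mul, coeff_mul_single, hf, mul_comm]
  congr 1
  obtain ⟨m, rfl⟩ := hk
  ext x
  rw [alphaPow_apply, ← mul_neg, hσ.zpow_mul_apply]

/-! ### Coefficients modulo the relation `δ ^ p = z` -/

section FiberCoeff

variable (p : ℕ) (z : Circle) (j : ℤ)

theorem summable_norm_coeff_add_mul (hp : 0 < p) (a : EllOne σ) :
    Summable fun m : ℤ => ‖a.coeff (j + p * m)‖ :=
  a.summable_norm.comp_injective fun m n h => by
    have hp' : (p : ℤ) ≠ 0 := by exact_mod_cast hp.ne'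
    exact mul_left_cancel₀ hp' (add_left_cancel h)

theorem norm_circle_zpow (m : ℤ) : ‖(z : ℂ) ^ m‖ = 1 := by
  rw [norm_zpow, Circle.norm_coe, one_zpow]

theorem norm_zpow_smul_coeff (m : ℤ) (a : EllOne σ) :
    ‖((z : ℂ) ^ m) • a.coeff (j + p * m)‖ = ‖a.coeff (j + p * m)‖ := by
  rw [norm_smul, norm_circle_zpow, one_mul]

theorem summable_zpow_smul_coeff (hp : 0 < p) (a : EllOne σ) :
    Summable fun m : ℤ => ((z : ℂ) ^ m) • a.coeff (j + p * m) :=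
  Summable.of_norm <| by
    simpa only [norm_zpow_smul_coeff] using summable_norm_coeff_add_mul p j hp a

/-- The `j`-th coefficient of `a ∈ ℓ¹(Σ)` modulo the relation `δ ^ p = z`. -/
noncomputable def fiberCoeff (a : EllOne σ) : C(X, ℂ) :=
  ∑' m : ℤ, ((z : ℂ) ^ m) • a.coeff (j + p * m)

theorem norm_fiberCoeff_le (hp : 0 < p) (a : EllOne σ) : ‖fiberCoeff p z j a‖ ≤ ‖a‖ := by
  have hs := summable_norm_coeff_add_mul p j hp a
  have hp' : (p : ℤ) ≠ 0 := by exact_mod_cast hp.ne'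
  refine (norm_tsum_le_tsum_norm (by simpa only [norm_zpow_smul_coeff] using hs)).trans ?_
  simp only [norm_zpow_smul_coeff]
  rw [norm_eq_tsum]
  exact tsum_comp_le_tsum_of_inj a.summable_norm (fun _ => norm_nonneg _)
    (i := fun m : ℤ => j + p * m) fun m n h => mul_left_cancel₀ hp' (add_left_cancel h)

variable (σ) in
/-- `fiberCoeff` as a continuous linear map. -/
noncomputable def fiberCoeffL (hp : 0 < p) : EllOne σ →L[ℂ] C(X, ℂ) :=
  LinearMap.mkContinuous
    { toFun := fiberCoeff p z j
      map_add' := fun a b => by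
        simp only [fiberCoeff, coeff_add, smul_add]
        exact (summable_zpow_smul_coeff p z j hp a).tsum_add (summable_zpow_smul_coeff p z j hp b)
      map_smul' := fun c a => by
        simp only [fiberCoeff, coeff_smul, smul_comm _ c, RingHom.id_apply]
        exact (summable_zpow_smul_coeff p z j hp a).tsum_const_smul c } 1
    fun a => by
      rw [one_mul]
      exact norm_fiberCoeff_le p z j hp a

theorem fiberCoeffL_apply (hp : 0 < p) (a : EllOne σ) :
    fiberCoeffL σ p z j hp a = fiberCoeff p z j a := rfl

variable {p j}

theorem fiberCoeff_single_of_eq (hp : 0 < p) {k m : ℤ} (hk : k = j + p * m) (f : C(X, ℂ)) :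
    fiberCoeff p z j (single σ k f) = ((z : ℂ) ^ m) • f := by
  have hp' : (p : ℤ) ≠ 0 := by exact_mod_cast hp.ne'
  rw [fiberCoeff, tsum_eq_single m fun n hn => ?_]
  · rw [hk, coeff_single_same]
  · rw [coeff_single, if_neg, smul_zero]
    rw [hk]
    exact fun h => hn (mul_left_cancel₀ hp' (add_left_cancel h))

theorem fiberCoeff_single_of_not_dvd {k : ℤ} (hk : ¬ (p : ℤ) ∣ k - j) (f : C(X, ℂ)) :
    fiberCoeff p z j (single σ k f) = 0 := by
  rw [fiberCoeff]
  refine (tsum_congr fun m => ?_).trans tsum_zero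
  rw [coeff_single, if_neg, smul_zero]
  rintro rfl
  exact hk ⟨m, by ring⟩

variable (p j)

theorem hasSum_fiberCoeff_apply (hp : 0 < p) (a : EllOne σ) (x : X) :
    HasSum (fun m : ℤ => (z : ℂ) ^ m * a.coeff (j + p * m) x) (fiberCoeff p z j a x) :=
  (summable_zpow_smul_coeff p z j hp a).hasSum.map (ContinuousMap.evalCLM ℂ x)
    (ContinuousMap.evalCLM ℂ x).continuous

/-- The Weierstrass M-test applies because scalars on the circle do not change the norms of the
terms. Joint continuity makes membership in the primitive ideals a closed condition on point and
scalar. -/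
theorem continuous_fiberCoeff_apply (hp : 0 < p) (a : EllOne σ) :
    Continuous fun y : X × Circle => fiberCoeff p y.2 j a y.1 := by
  have : (fun y : X × Circle => fiberCoeff p y.2 j a y.1) =
      fun y => ∑' m : ℤ, (y.2 : ℂ) ^ m * a.coeff (j + p * m) y.1 :=
    funext fun y => (hasSum_fiberCoeff_apply p y.2 j hp a y.1).tsum_eq.symm
  rw [this]
  refine continuous_tsum (fun m => ?_) (summable_norm_coeff_add_mul p j hp a) fun m y => ?_
  · refine Continuous.mul ?_ ((a.coeff _).continuous.comp continuous_fst)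
    exact (continuous_subtype_val.comp continuous_snd).zpow₀ m fun y => Or.inl (Circle.coe_ne_zero _)
  · rw [norm_mul, norm_circle_zpow, one_mul]
    exact ContinuousMap.norm_coe_le_norm _ _

/-- Shifting the summation index shows that only `j` modulo `p` matters, up to a non-zero factor. -/
theorem fiberCoeff_add_mul (m : ℤ) (a : EllOne σ) :
    fiberCoeff p z (j + p * m) a = ((z : ℂ) ^ (-m)) • fiberCoeff p z j a := by
  rw [fiberCoeff, fiberCoeff, ← tsum_const_smul'']
  refine ((Equiv.addLeft (-m)).tsum_eq
    fun n : ℤ => ((z : ℂ) ^ n) • a.coeff (j + p * m + p * n)).symm.trans (tsum_congr fun n => ?_)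
  rw [smul_smul, Equiv.coe_addLeft, ← zpow_add₀ (Circle.coe_ne_zero z)]
  congr 2
  ring

end FiberCoeff

end EllOne

/-! ### The kernel of an irreducible representation of `ℓ¹(Σ)` -/

/-- Urysohn's lemma. Nonnegativity is recorded so that sums over an orbit cannot cancel. -/
theorem exists_continuousMap_eq_one_of_mem_isOpen {X : Type*} [TopologicalSpace X] [CompactSpace X]
    [T2Space X] {x : X} {U : Set X} (hU : IsOpen U) (hx : x ∈ U) :
    ∃ f : C(X, ℝ), f x = 1 ∧ (∀ y ∉ U, f y = 0) ∧ ∀ y, 0 ≤ f y := by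
  obtain ⟨f, hf0, hf1, hf⟩ := exists_continuous_zero_one_of_isClosed hU.isClosed_compl
    (isClosed_singleton (x := x)) (by simpa using hx)
  exact ⟨f, hf1 rfl, fun y hy => hf0 hy, fun y => (hf y).1⟩

/-- The other `p - 1` points of the orbit form a finite, hence closed, set. On the orbit such a
function acts as the projection onto one coordinate. -/
theorem HasExactPeriod.exists_bump {X : Type*} [TopologicalSpace X] [CompactSpace X]
    [T2Space X] {σ : X ≃ₜ X} {p : ℕ} (hσ : HasExactPeriod σ p) (x : X) :
    ∃ f : C(X, ℂ), ∀ n : ℤ, f ((σ ^ n) x) = if (p : ℤ) ∣ n then 1 else 0 := by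
  let S : Set X := (fun i : ℕ => (σ ^ (i : ℤ)) x) '' {i : ℕ | i < p ∧ i ≠ 0}
  have hS : IsClosed S := (((Set.finite_lt_nat p).subset fun i hi => hi.1).image _).isClosed
  have hxS : x ∈ Sᶜ := by
    rintro ⟨i, ⟨hip, hi0⟩, hix⟩
    have := Nat.le_of_dvd (Nat.pos_of_ne_zero hi0)
      (Int.natCast_dvd_natCast.1 ((hσ.zpow_apply_eq_self_iff x i).1 hix))
    omega
  obtain ⟨f, hf1, hf0, -⟩ := exists_continuousMap_eq_one_of_mem_isOpen hS.isOpen_compl hxS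
  refine ⟨⟨fun y => (f y : ℂ), by fun_prop⟩, fun n => ?_⟩
  rw [ContinuousMap.coe_mk]
  split_ifs with h
  · rw [(hσ.zpow_apply_eq_self_iff x n).2 h, hf1, Complex.ofReal_one]
  · rw [hf0, Complex.ofReal_zero]
    obtain ⟨i, hi, m, rfl⟩ := hσ.exists_natCast_add n
    rw [Set.notMem_compl_iff]
    refine ⟨i, ⟨Finset.mem_range.1 hi, ?_⟩, ?_⟩
    · rintro rfl
      simp at h
    · rw [Homeomorph.zpow_add_apply, hσ.zpow_mul_apply]

namespace EllOne

variable {X : Type*} [TopologicalSpace X] [CompactSpace X]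
  {σ : X ≃ₜ X} {p : ℕ} {E : Type*} [AddCommGroup E] [Module ℂ E]
  {π : EllOne σ →ₙₐ[ℂ] Module.End ℂ E}

theorem norm_single_le (k : ℤ) (f : C(X, ℂ)) : ‖single σ k f‖ ≤ ‖f‖ := by
  rw [norm_eq_tsum, tsum_eq_single k fun n hn => by simp [coeff_single, hn]]
  simp

/-- The central elements `δ ^ (p m)` act by scalars `c m`, multiplicative in `m` and bounded by `‖δ
^ (p m)‖ ≤ 1`. Applied to both `1` and `-1`, the bound gives `‖c 1‖ = 1`. -/
theorem exists_map_single_period [Nonempty X] (hσ : HasExactPeriod σ p) (hπ : IsAlgIrreducible π) :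
    ∃ z : Circle, ∀ m : ℤ, π (single σ (p * m) 1) = ((z : ℂ) ^ m) • 1 := by
  have hc : ∀ m : ℤ, ∃ c : ℂ, π (single σ (p * m) 1) = c • 1 := fun m =>
    hπ.exists_map_eq_smul (commute_of_forall_alphaPow_eq hσ (dvd_mul_right _ _) fun n => map_one _)
  choose c hc using hc
  have hn : ∀ m, ‖c m‖ ≤ 1 := fun m =>
    (hπ.norm_le_of_map_eq_smul (hc m)).trans ((norm_single_le _ _).trans (by simp))
  obtain ⟨v, hv⟩ := hπ.exists_vec_ne_zero
  have hinj : ∀ {c d : ℂ}, (c • 1 : Module.End ℂ E) = d • 1 → c = d := fun h =>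
    smul_left_injective ℂ hv (LinearMap.congr_fun h v)
  have hmul : ∀ m n, c (m + n) = c m * c n := fun m n => hinj <| by
    rw [← hc, mul_add, ← single_mul_single_one, map_mul, hc, hc, smul_mul_smul_comm, one_mul]
  have h0 : c 0 = 1 := hinj <| by
    rw [← hc, mul_zero, single_zero_one, hπ.map_one, one_smul]
  have hne : ∀ m, c m ≠ 0 := fun m hm => by
    have := hmul m (-m)
    rw [add_neg_cancel, h0, hm, zero_mul] at this
    exact one_ne_zero this
  have h1 : ‖c 1‖ = 1 := by
    refine le_antisymm (hn 1) ?_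
    have := congrArg norm (hmul 1 (-1))
    rw [add_neg_cancel, h0, norm_one, norm_mul] at this
    rw [this]
    exact mul_le_of_le_one_right (norm_nonneg _) (hn _)
  refine ⟨⟨c 1, mem_sphere_zero_iff_norm.2 h1⟩, fun m => ?_⟩
  rw [hc]
  congr 1
  change c m = c 1 ^ m
  induction m using Int.induction_on with
  | zero => rw [h0, zpow_zero]
  | succ n ih => rw [hmul, ih, zpow_add_one₀ (hne 1)]
  | pred n ih =>
    refine mul_right_cancel₀ (hne 1) ?_
    rw [← hmul, sub_add_cancel, ih, ← zpow_add_one₀ (hne 1), sub_add_cancel]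

section Schur

variable {z : Circle} (hz : ∀ m : ℤ, π (single σ (p * m) 1) = ((z : ℂ) ^ m) • 1)
include hz

theorem map_single_add_mul (j m : ℤ) (f : C(X, ℂ)) :
    π (single σ (j + p * m) f) = ((z : ℂ) ^ m) • π (single σ j f) := by
  rw [← single_mul_single_one, map_mul, hz, mul_smul_comm, mul_one]

/-- Modulo the kernel of `π`, every element is a finite sum. -/
theorem map_eq_sum_fiberCoeff (hσ : HasExactPeriod σ p) (hπ : IsAlgIrreducible π) (a : EllOne σ) :
    π a = ∑ j ∈ Finset.range p, π (single σ j (fiberCoeff p z j a)) := by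
  -- `R` is the difference between `a` and its proposed finite sum. It is continuous and maps each
  -- `single σ k f` into the closed kernel of `π`, hence maps every `a` there by `hasSum_single`.
  let R : EllOne σ →L[ℂ] EllOne σ := ContinuousLinearMap.id ℂ _ -
    ∑ j ∈ Finset.range p, (single σ j).comp (fiberCoeffL σ p z j hσ.pos)
  have hR : ∀ a, R a = a - ∑ j ∈ Finset.range p, single σ j (fiberCoeff p z j a) := fun a => by
    simp [R, fiberCoeffL_apply, sum_apply]
  have hs : ∀ k f, R (single σ k f) ∈ LinearMap.ker (π : EllOne σ →ₗ[ℂ] Module.End ℂ E) := by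
    intro k f
    obtain ⟨i, hi, m, rfl⟩ := hσ.exists_natCast_add k
    rw [LinearMap.mem_ker, hR, Finset.sum_eq_single i (fun j hj hji => ?_) fun h => absurd hi h]
    · rw [fiberCoeff_single_of_eq z hσ.pos rfl]
      change π _ = 0
      rw [map_sub, map_single_add_mul hz, map_smul, map_smul, sub_self]
    · rw [fiberCoeff_single_of_not_dvd, map_zero]
      rw [add_sub_right_comm, dvd_add_left (dvd_mul_right _ _)]
      exact fun h => hji (eq_of_dvd_natCast_sub (Finset.mem_range.1 hi) (Finset.mem_range.1 hj) h).symm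
  have hmem : π (R a) = 0 := by
    refine hπ.isClosed_ker.mem_of_tendsto (a.hasSum_single.map R R.continuous)
      (Filter.Eventually.of_forall fun s => ?_)
    exact Submodule.sum_mem _ fun k _ => hs k _
  rw [hR, map_sub, map_sum, sub_eq_zero] at hmem
  exact hmem

end Schur

/-! ### The orbit determined by an irreducible representation -/

section Point

variable [T2Space X]

/-- The functions that an irreducible representation annihilates contain those that vanish on a
suitable orbit. -/
theorem exists_point (hσ : HasExactPeriod σ p) (hπ : IsAlgIrreducible π) :
    ∃ x : X, ∀ f : C(X, ℂ), (∀ n : ℤ, f ((σ ^ n) x) = 0) → π (single σ 0 f) = 0 := by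
  let I : Ideal C(X, ℂ) :=
    { carrier := {f | π (single σ 0 f) = 0}
      add_mem' := fun {f g} hf hg => by
        rw [Set.mem_ofPred_eq] at *
        rw [map_add, map_add, hf, hg, add_zero]
      zero_mem' := by simp
      smul_mem' := fun c f hf => by
        rw [Set.mem_ofPred_eq] at *
        rw [smul_eq_mul, ← single_zero_mul_single, map_mul, hf, mul_zero] }
  have hI : ∀ f, f ∈ I ↔ π (single σ 0 f) = 0 := fun f => Iff.rfl
  have hcl : IsClosed (I : Set C(X, ℂ)) := hπ.isClosed_ker.preimage (single σ 0).continuous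
  have hne : I ≠ ⊤ := by
    rw [Ideal.ne_top_iff_one, hI, single_zero_one]
    exact hπ.map_ne_zero_of_isUnit isUnit_one
  obtain ⟨M, hM, hIM⟩ := Ideal.exists_le_maximal I hne
  -- Maximal ideals of `C(X)` are points, so all of `I` vanishes at some `x`.
  obtain ⟨x, hx⟩ := ContinuousMap.setOfIdeal_eq_compl_singleton M
  have hxI : ∀ f ∈ I, f x = 0 := fun f hf =>
    ContinuousMap.notMem_setOfIdeal.1 (by rw [hx]; simp) (hIM hf)
  refine ⟨x, fun f hf => ?_⟩
  -- `F` is invariant, so it acts by a scalar `c`. Then `F - c • 1 ∈ I` vanishes at `x`, as does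
  -- `F`, whence `c = 0` and `F ∈ I`.
  let F : C(X, ℂ) := orbitSum σ p (star f * f)
  have hFx : ∀ y, F y = ∑ i ∈ Finset.range p, ((‖f ((σ ^ (-(i : ℤ))) y)‖ ^ 2 : ℝ) : ℂ) := fun y => by
    simp only [F, orbitSum_apply, ContinuousMap.mul_apply, ContinuousMap.star_apply]
    refine Finset.sum_congr rfl fun i _ => ?_
    rw [RCLike.star_def, RCLike.conj_mul]
    norm_cast
  have hF : F ∈ I := by
    obtain ⟨c, hc⟩ := hπ.exists_map_eq_smul
      (commute_of_forall_alphaPow_eq hσ (dvd_zero _) (alphaPow_orbitSum hσ (star f * f)))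
    have h1 : F - c • 1 ∈ I := by
      rw [hI, map_sub, map_sub, hc, map_smul, single_zero_one, map_smul, hπ.map_one, sub_self]
    have h2 := hxI _ h1
    have h3 : F x = 0 := by
      rw [hFx]
      exact Finset.sum_eq_zero fun i _ => by rw [hf, norm_zero]; simp
    have h4 : c = 0 := by simpa [h3] using h2
    rw [hI, hc, h4, zero_smul]
  -- A closed ideal contains every function vanishing at its common zeros. At such a zero `F = ∑ |f
  -- ∘ σ ^ (-i)| ^ 2` vanishes, and the term `i = 0` gives `f y = 0`.
  rw [← hI, ← ContinuousMap.idealOfSet_ofIdeal_isClosed hcl, ContinuousMap.mem_idealOfSet]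
  intro y hy
  have h0 := ContinuousMap.notMem_setOfIdeal.1 hy hF
  rw [hFx] at h0
  have h0' : ∑ i ∈ Finset.range p, ‖f ((σ ^ (-(i : ℤ))) y)‖ ^ 2 = 0 := by exact_mod_cast h0
  have := (Finset.sum_eq_zero_iff_of_nonneg fun i _ => by positivity).1 h0' 0
    (Finset.mem_range.2 hσ.pos)
  simpa only [Nat.cast_zero, neg_zero, zpow_zero, Homeomorph.one_apply, sq_eq_zero_iff,
    norm_eq_zero] using this

variable {x : X} {z : Circle}

/-- Suppose the coefficient `f_j` is non-zero at a point `y` of the orbit. Bumps on both sides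
isolate the `j`-th term of `π a = 0`, so `π` kills `h * f_j * h`, which agrees on the orbit with
`f_j y • h`. Hence `h` is killed, and so are its conjugates by powers of `δ`. Their sum over a
period is `1` on the orbit, contradicting `π 1 ≠ 0`. -/
theorem fiberCoeff_apply_eq_zero_of_map_eq_zero (hσ : HasExactPeriod σ p) (hπ : IsAlgIrreducible π)
    (hz : ∀ m : ℤ, π (single σ (p * m) 1) = ((z : ℂ) ^ m) • 1)
    (hx : ∀ f : C(X, ℂ), (∀ n : ℤ, f ((σ ^ n) x) = 0) → π (single σ 0 f) = 0)
    {a : EllOne σ} (ha : π a = 0) {j : ℕ} (hj : j < p) (n : ℤ) :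
    fiberCoeff p z j a ((σ ^ n) x) = 0 := by
  have hx' : ∀ (k : ℤ) (f : C(X, ℂ)), (∀ m : ℤ, f ((σ ^ m) ((σ ^ n) x)) = 0) →
      π (single σ k f) = 0 := fun k f hf => by
    rw [← zero_add k, ← single_mul_single_one, map_mul, hx, zero_mul]
    intro m
    have := hf (m - n)
    rwa [← Homeomorph.zpow_add_apply, sub_add_cancel] at this
  generalize (σ ^ n) x = y at hx'
  by_contra hy
  obtain ⟨h, hh⟩ := hσ.exists_bump y
  have hα : ∀ k m : ℤ, alphaPow σ k h ((σ ^ m) y) = if (p : ℤ) ∣ m - k then 1 else 0 := fun k m => by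
    rw [alphaPow_apply, ← Homeomorph.zpow_add_apply, hh, neg_add_eq_sub]
  have h1 : π (single σ j (h * fiberCoeff p z j a * h)) = 0 := by
    have hs := map_eq_sum_fiberCoeff hz hσ hπ a
    rw [ha] at hs
    -- The twist by `-j` on the right turns the `i`-th term into `h * f_i * α ^ (i - j) h` at `δ ^
    -- i`. On the orbit `h * α ^ (i - j) h` vanishes unless `i = j`.
    have := congrArg (fun T => π (single σ 0 h) * T * π (single σ 0 (alphaPow σ (-j) h))) hs
    simp only [mul_zero, zero_mul, Finset.mul_sum, Finset.sum_mul] at this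
    rw [Finset.sum_eq_single j (fun i hi hij => ?_) fun h => absurd (Finset.mem_range.2 hj) h] at this
    · rw [← map_mul, ← map_mul, single_zero_mul_single, single_mul_single, alphaPow_alphaPow,
        add_neg_cancel, alphaPow_zero, add_zero] at this
      exact this.symm
    · rw [← map_mul, ← map_mul, single_zero_mul_single, single_mul_single, alphaPow_alphaPow]
      refine hx' _ _ fun m => ?_
      rw [ContinuousMap.mul_apply, ContinuousMap.mul_apply, hα, hh]
      split_ifs with hm hm'
      · refine absurd (eq_of_dvd_natCast_sub (Finset.mem_range.1 hi) hj ?_) hij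
        have := dvd_sub hm hm'
        rwa [sub_sub_cancel, ← sub_eq_add_neg] at this
      all_goals simp
  have h2 : π (single σ 0 (h * fiberCoeff p z j a * h)) = 0 := by
    rw [← add_neg_cancel (j : ℤ), ← single_mul_single_one, map_mul, h1, zero_mul]
  have h3 : π (single σ 0 h) = 0 := by
    have := hx' 0 (h * fiberCoeff p z j a * h - fiberCoeff p z j a y • h) fun m => by
      rw [ContinuousMap.sub_apply, ContinuousMap.mul_apply, ContinuousMap.mul_apply,
        ContinuousMap.smul_apply, hh]
      split_ifs with hm
      · rw [(hσ.zpow_apply_eq_self_iff y m).2 hm]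
        simp
      · simp
    rw [map_sub, map_sub, h2, map_smul, map_smul, zero_sub, neg_eq_zero, smul_eq_zero] at this
    exact this.resolve_left hy
  have h4 : ∀ k : ℤ, π (single σ 0 (alphaPow σ k h)) = 0 := fun k => by
    have : single σ 0 (alphaPow σ k h) = single σ k 1 * single σ 0 h * single σ (-k) 1 := by
      rw [single_mul_single, single_mul_single_one, one_mul, add_zero, add_neg_cancel]
    rw [this, map_mul, map_mul, h3, mul_zero, zero_mul]
  refine hπ.map_ne_zero_of_isUnit isUnit_one ?_
  have h5 := hx' 0 (1 - orbitSum σ p h) fun m => by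
    obtain ⟨i, hi, l, rfl⟩ := hσ.exists_natCast_add m
    rw [ContinuousMap.sub_apply, orbitSum_apply, ContinuousMap.one_apply, sub_eq_zero, eq_comm,
      Finset.sum_eq_single i (fun k hk hki => ?_) fun h => absurd hi h]
    · rw [← alphaPow_apply, hα, if_pos]
      rw [add_sub_cancel_left]
      exact dvd_mul_right _ _
    · rw [← alphaPow_apply, hα, if_neg]
      rw [add_sub_right_comm, dvd_add_left (dvd_mul_right _ _)]
      exact fun h => hki (eq_of_dvd_natCast_sub (Finset.mem_range.1 hi) (Finset.mem_range.1 hk) h).symm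
  rw [map_sub, map_sub, single_zero_one, sub_eq_zero] at h5
  rw [h5, orbitSum, map_sum, map_sum]
  exact Finset.sum_eq_zero fun i _ => h4 i

/-- The kernel of an irreducible representation is determined by a point and a scalar. -/
theorem exists_map_eq_zero_iff [Nonempty X] (hσ : HasExactPeriod σ p) (hπ : IsAlgIrreducible π) :
    ∃ (x : X) (z : Circle), ∀ a, π a = 0 ↔ ∀ j n : ℤ, fiberCoeff p z j a ((σ ^ n) x) = 0 := by
  obtain ⟨z, hz⟩ := exists_map_single_period hσ hπ
  obtain ⟨x, hx⟩ := exists_point hσ hπ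
  refine ⟨x, z, fun a => ⟨fun ha j n => ?_, fun ha => ?_⟩⟩
  · obtain ⟨i, hi, m, rfl⟩ := hσ.exists_natCast_add j
    rw [fiberCoeff_add_mul, ContinuousMap.smul_apply, fiberCoeff_apply_eq_zero_of_map_eq_zero hσ hπ
      hz hx ha (Finset.mem_range.1 hi), smul_zero]
  · rw [map_eq_sum_fiberCoeff hz hσ hπ a]
    refine Finset.sum_eq_zero fun j _ => ?_
    rw [← zero_add (j : ℤ), ← single_mul_single_one, map_mul, zero_add, hx _ (ha j), zero_mul]

end Point

end EllOne

/-! ### The irreducible representations attached to orbits and scalars -/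

/-- The kernel of an irreducible representation on a space in the lowest universe
is primitive. -/
theorem IsAlgIrreducible.isPrimitiveIdeal_ker.{u} {A : Type u} [NonUnitalRing A] [Module ℂ A]
    {E : Type} [AddCommGroup E] [Module ℂ E] {π : A →ₙₐ[ℂ] Module.End ℂ E}
    (hπ : IsAlgIrreducible π) : IsPrimitiveIdeal (TwoSidedIdeal.ker π) := by
  -- `IsPrimitiveIdeal` requires the space to live in the universe of `A`.
  let e : E ≃ₗ[ℂ] ULift.{u} E := ULift.moduleEquiv.symm
  let ρ : A →ₙₐ[ℂ] Module.End ℂ (ULift.{u} E) :=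
    NonUnitalAlgHom.comp (NonUnitalAlgHomClass.toNonUnitalAlgHom (e.conjAlgEquiv ℂ)) π
  have hρ : ∀ a v, ρ a (e v) = e (π a v) := fun a v => by
    change e (π a (e.symm (e v))) = _
    rw [e.symm_apply_apply]
  refine ⟨ULift.{u} E, inferInstance, inferInstance, ρ, ⟨?_, fun W hW => ?_⟩, ?_⟩
  · obtain ⟨a, v, hav⟩ := hπ.nonzero
    exact ⟨a, e v, by rwa [hρ, Ne, LinearEquiv.map_eq_zero_iff]⟩
  · have hmap : (W.comap (e : E →ₗ[ℂ] ULift.{u} E)).map (e : E →ₗ[ℂ] ULift.{u} E) = W :=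
      Submodule.map_comap_eq_of_surjective e.surjective W
    rcases hπ.eq_bot_or_top (W.comap (e : E →ₗ[ℂ] ULift.{u} E)) (fun a w hw => by
      rw [Submodule.mem_comap] at hw ⊢
      have := hW a _ hw
      rwa [LinearEquiv.coe_coe, hρ] at this) with h | h
    · exact Or.inl (by rw [← hmap, h, Submodule.map_bot])
    · refine Or.inr ?_
      rw [← hmap, h, Submodule.map_top, LinearEquiv.range]
  · refine TwoSidedIdeal.ext fun a => ?_
    rw [TwoSidedIdeal.mem_ker, TwoSidedIdeal.mem_ker]
    exact (EmbeddingLike.map_eq_zero_iff (f := e.conjAlgEquiv ℂ)).symm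

/-- The two-sided sequences with `ξ (n + p) = z⁻¹ ξ n`. -/
def twistedPeriodic (p : ℕ) (z : Circle) : Submodule ℂ (ℤ → ℂ) where
  carrier := {ξ | ∀ n m : ℤ, ξ (n + p * m) = (z : ℂ) ^ (-m) * ξ n}
  add_mem' hξ hη n m := by rw [Pi.add_apply, Pi.add_apply, hξ, hη, mul_add]
  zero_mem' n m := by simp
  smul_mem' c ξ hξ n m := by rw [Pi.smul_apply, Pi.smul_apply, hξ, smul_eq_mul, smul_eq_mul,
    mul_left_comm]

namespace twistedPeriodic

variable {p : ℕ} {z : Circle}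

theorem apply_add_mul (ξ : twistedPeriodic p z) (n m : ℤ) :
    ξ.1 (n + p * m) = (z : ℂ) ^ (-m) * ξ.1 n := ξ.2 n m

/-- The sequence supported on `i + p ℤ` with value `1` at `i`. -/
noncomputable def basisVec (hp : 0 < p) (z : Circle) (i : ℤ) : twistedPeriodic p z where
  val n := if (p : ℤ) ∣ n - i then (z : ℂ) ^ (-((n - i) / p)) else 0
  property n m := by
    have hp' : (p : ℤ) ≠ 0 := by exact_mod_cast hp.ne'
    have h : n + p * m - i = n - i + p * m := by ring
    simp only [h, dvd_add_left (dvd_mul_right (p : ℤ) m), Int.add_mul_ediv_left _ _ hp', mul_ite,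
      mul_zero, neg_add, zpow_add₀ (Circle.coe_ne_zero z)]
    split_ifs
    · exact mul_comm _ _
    · rfl

theorem basisVec_add_mul (hp : 0 < p) (i m : ℤ) :
    (basisVec hp z i).1 (i + p * m) = (z : ℂ) ^ (-m) := by
  rw [apply_add_mul]
  simp [basisVec]

theorem basisVec_of_not_dvd (hp : 0 < p) {i n : ℤ} (h : ¬ (p : ℤ) ∣ n - i) :
    (basisVec hp z i).1 n = 0 := if_neg h

theorem basisVec_sub (hp : 0 < p) (i n k : ℤ) :
    (basisVec hp z i).1 (n - k) = (basisVec hp z (i + k)).1 n := by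
  simp only [basisVec, sub_sub, add_comm]

end twistedPeriodic

section

variable {X : Type*} [TopologicalSpace X] {σ : X ≃ₜ X} {p : ℕ} {z : Circle}

open twistedPeriodic

theorem HasExactPeriod.eq_sum_basisVec (hσ : HasExactPeriod σ p) (ξ : twistedPeriodic p z) :
    ξ = ∑ i ∈ Finset.range p, ξ.1 i • basisVec hσ.pos z i := by
  refine Subtype.ext (funext fun n => ?_)
  obtain ⟨i, hi, m, rfl⟩ := hσ.exists_natCast_add n
  rw [Submodule.coe_sum, Finset.sum_apply, Finset.sum_eq_single i (fun j hj hji => ?_)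
    fun h => absurd hi h]
  · rw [Submodule.coe_smul, Pi.smul_apply, basisVec_add_mul, apply_add_mul, smul_eq_mul, mul_comm]
  · rw [Submodule.coe_smul, Pi.smul_apply, basisVec_of_not_dvd, smul_zero]
    rw [add_sub_right_comm, dvd_add_left (dvd_mul_right _ _)]
    exact fun h => hji (eq_of_dvd_natCast_sub (Finset.mem_range.1 hi) (Finset.mem_range.1 hj) h).symm

theorem HasExactPeriod.exists_norm_le (hσ : HasExactPeriod σ p) (ξ : twistedPeriodic p z) :
    ∃ C, ∀ n, ‖ξ.1 n‖ ≤ C := by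
  refine ⟨∑ i ∈ Finset.range p, ‖ξ.1 i‖, fun n => ?_⟩
  obtain ⟨i, hi, m, rfl⟩ := hσ.exists_natCast_add n
  rw [apply_add_mul, norm_mul, EllOne.norm_circle_zpow, one_mul]
  exact Finset.single_le_sum (f := fun i : ℕ => ‖ξ.1 i‖) (fun _ _ => norm_nonneg _) hi

end

namespace EllOne

open twistedPeriodic

variable {X : Type*} [TopologicalSpace X] [CompactSpace X] {σ : X ≃ₜ X} {p : ℕ}

section Rep

variable (hσ : HasExactPeriod σ p) (x : X) (z : Circle)
include hσ

theorem summable_rep (a : EllOne σ) (ξ : twistedPeriodic p z) (n : ℤ) :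
    Summable fun k => a.coeff k ((σ ^ n) x) * ξ.1 (n - k) := by
  obtain ⟨C, hC⟩ := hσ.exists_norm_le ξ
  refine Summable.of_norm_bounded (a.summable_norm.mul_right C) fun k => ?_
  rw [norm_mul]
  exact mul_le_mul (ContinuousMap.norm_coe_le_norm _ _) (hC _) (norm_nonneg _) (norm_nonneg _)

/-- Multiplicativity of `rep`: interchange the two sums and substitute `m = k + l`. The twist `α ^
k` moves the evaluation point from `σ ^ n x` to `σ ^ (n - k) x`. -/
theorem rep_mul_aux (a b : EllOne σ) (ξ : twistedPeriodic p z) (n : ℤ) :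
    ∑' m, (a * b).coeff m ((σ ^ n) x) * ξ.1 (n - m) =
      ∑' k, a.coeff k ((σ ^ n) x) *
        ∑' l, b.coeff l ((σ ^ (n - k)) x) * ξ.1 (n - k - l) := by
  obtain ⟨C, hC⟩ := hσ.exists_norm_le ξ
  let F : ℤ × ℤ → ℂ := fun q => mulTerm a b q.1 q.2 ((σ ^ n) x) * ξ.1 (n - q.1)
  have hF : Summable F := by
    refine Summable.of_norm_bounded ((summable_norm_mulTerm a b).mul_right C) fun q => ?_
    rw [norm_mul]
    exact mul_le_mul (ContinuousMap.norm_coe_le_norm _ _) (hC _) (norm_nonneg _) (norm_nonneg _)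
  have hl : ∀ m, (a * b).coeff m ((σ ^ n) x) * ξ.1 (n - m) = ∑' k, F (m, k) := fun m =>
    ((((hasSum_coeff_mul a b m).map (ContinuousMap.evalCLM ℂ ((σ ^ n) x))
      (ContinuousMap.evalCLM ℂ _).continuous)).mul_right _).tsum_eq.symm
  rw [tsum_congr hl, ← Summable.tsum_comm (f := fun m k => F (m, k)) hF]
  refine tsum_congr fun k => ?_
  rw [← tsum_mul_left, ← (Equiv.addLeft k).tsum_eq]
  refine tsum_congr fun m => ?_
  simp only [F, mulTerm, ContinuousMap.mul_apply, alphaPow_apply, Equiv.coe_addLeft,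
    ← Homeomorph.zpow_add_apply, mul_assoc, sub_sub, neg_add_eq_sub, add_sub_cancel_left]

/-- The representation of `ℓ¹(Σ)` on twisted periodic sequences in which `C(X)` acts through the
values along the orbit of `x`, and `δ` acts by translation. -/
noncomputable def rep : EllOne σ →ₙₐ[ℂ] Module.End ℂ (twistedPeriodic p z) where
  toFun a :=
    { toFun := fun ξ =>
        { val := fun n => ∑' k, a.coeff k ((σ ^ n) x) * ξ.1 (n - k)
          property := fun n m => by
            simp only [Homeomorph.zpow_add_apply, hσ.zpow_mul_apply, add_sub_right_comm,
              apply_add_mul, mul_left_comm _ ((z : ℂ) ^ (-m)), tsum_mul_left] }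
      map_add' := fun ξ η => Subtype.ext <| funext fun n => by
        simp only [Submodule.coe_add, Pi.add_apply, mul_add]
        exact (summable_rep hσ x z a ξ n).tsum_add (summable_rep hσ x z a η n)
      map_smul' := fun c ξ => Subtype.ext <| funext fun n => by
        simp only [Submodule.coe_smul, Pi.smul_apply, smul_eq_mul, mul_left_comm _ c,
          tsum_mul_left, RingHom.id_apply] }
  map_smul' c a := LinearMap.ext fun ξ => Subtype.ext <| funext fun n => by
    simp [mul_assoc, tsum_mul_left]
  map_zero' := LinearMap.ext fun ξ => Subtype.ext <| funext fun n => by simp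
  map_add' a b := LinearMap.ext fun ξ => Subtype.ext <| funext fun n => by
    simp only [coeff_add, ContinuousMap.add_apply, add_mul]
    exact (summable_rep hσ x z a ξ n).tsum_add (summable_rep hσ x z b ξ n)
  map_mul' a b := LinearMap.ext fun ξ => Subtype.ext <| funext fun n =>
    rep_mul_aux hσ x z a b ξ n

theorem rep_apply (a : EllOne σ) (ξ : twistedPeriodic p z) (n : ℤ) :
    (rep hσ x z a ξ).1 n = ∑' k, a.coeff k ((σ ^ n) x) * ξ.1 (n - k) := rfl

theorem rep_single (k : ℤ) (f : C(X, ℂ)) (ξ : twistedPeriodic p z) (n : ℤ) :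
    (rep hσ x z (single σ k f) ξ).1 n = f ((σ ^ n) x) * ξ.1 (n - k) := by
  rw [rep_apply, tsum_eq_single k fun m hm => by simp [coeff_single, hm], coeff_single_same]

/-- The basis vector is supported on one residue class, so only `k ∈ n - i + p ℤ` contribute, and
these form the series of `fiberCoeff`. The matrix entries thus give the kernel of `rep` the form
found in `exists_map_eq_zero_iff`. -/
theorem rep_basisVec (a : EllOne σ) (i n : ℤ) :
    (rep hσ x z a (basisVec hσ.pos z i)).1 n = fiberCoeff p z (n - i) a ((σ ^ n) x) := by
  have hp : (p : ℤ) ≠ 0 := by exact_mod_cast hσ.pos.ne'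
  rw [rep_apply, ← (hasSum_fiberCoeff_apply p z (n - i) hσ.pos a ((σ ^ n) x)).tsum_eq]
  have hinj : Function.Injective fun m : ℤ => n - i + p * m := fun m l h =>
    mul_left_cancel₀ hp (add_left_cancel h)
  rw [← hinj.tsum_eq]
  · refine tsum_congr fun m => ?_
    have : n - (n - i + p * m) = i + p * (-m) := by ring
    rw [this, basisVec_add_mul, neg_neg, mul_comm]
  · intro k hk
    by_contra hkr
    refine hk ?_
    change a.coeff k _ * (basisVec hσ.pos z i).1 (n - k) = 0
    rw [basisVec_of_not_dvd, mul_zero]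
    rintro ⟨m, hm⟩
    exact hkr ⟨-m, by linear_combination hm⟩

theorem rep_eq_zero_iff (a : EllOne σ) :
    rep hσ x z a = 0 ↔ ∀ j n : ℤ, fiberCoeff p z j a ((σ ^ n) x) = 0 := by
  constructor
  · intro h j n
    have := rep_basisVec hσ x z a (n - j) n
    rw [h, sub_sub_cancel] at this
    exact this.symm
  · intro h
    refine LinearMap.ext fun ξ => ?_
    rw [hσ.eq_sum_basisVec ξ, map_sum]
    refine Finset.sum_eq_zero fun i _ => ?_
    rw [map_smul]
    have : rep hσ x z a (basisVec hσ.pos z i) = 0 := Subtype.ext <| funext fun n => by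
      rw [rep_basisVec, h]
      rfl
    rw [this, smul_zero]

/-- A bump at a suitable point of the orbit cuts a non-zero vector down to a multiple of one basis
vector, and powers of `δ` carry that vector to all the others. -/
theorem isAlgIrreducible_rep [T2Space X] : IsAlgIrreducible (rep hσ x z) where
  nonzero := by
    refine ⟨1, basisVec hσ.pos z 0, fun h => ?_⟩
    have h0 := congrFun (congrArg Subtype.val h) 0
    rw [← single_zero_one, rep_single] at h0
    simp [basisVec] at h0
  eq_bot_or_top W hW := by
    refine or_iff_not_imp_left.2 fun hne => ?_
    obtain ⟨ξ, hξ, hξ0⟩ := (Submodule.ne_bot_iff W).1 hne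
    obtain ⟨n, hn⟩ : ∃ n, ξ.1 n ≠ 0 := by
      by_contra! h
      exact hξ0 (Subtype.ext (funext h))
    obtain ⟨h, hh⟩ := hσ.exists_bump ((σ ^ n) x)
    have h1 : rep hσ x z (single σ 0 h) ξ = ξ.1 n • basisVec hσ.pos z n :=
      Subtype.ext <| funext fun m => by
        have hm := hh (m - n)
        rw [← Homeomorph.zpow_add_apply, sub_add_cancel] at hm
        rw [rep_single, hm, sub_zero, Submodule.coe_smul, Pi.smul_apply]
        split_ifs with hd
        · obtain ⟨k, hk⟩ := hd
          obtain rfl : m = n + p * k := by linear_combination hk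
          rw [basisVec_add_mul, apply_add_mul, one_mul, smul_eq_mul, mul_comm]
        · rw [basisVec_of_not_dvd _ hd, zero_mul, smul_zero]
    have h2 : basisVec hσ.pos z n ∈ W := (W.smul_mem_iff hn).1 (h1 ▸ hW _ _ hξ)
    have h3 : ∀ i, basisVec hσ.pos z i ∈ W := fun i => by
      have : rep hσ x z (single σ (i - n) 1) (basisVec hσ.pos z n) = basisVec hσ.pos z i :=
        Subtype.ext <| funext fun m => by
          rw [rep_single, basisVec_sub, add_sub_cancel, ContinuousMap.one_apply, one_mul]
      exact this ▸ hW _ _ h2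
    rw [eq_top_iff]
    intro η _
    rw [hσ.eq_sum_basisVec η]
    exact W.sum_mem fun i _ => W.smul_mem _ (h3 i)

end Rep

end EllOne

/-! ### Regularity of the Wiener algebra -/

/-- This is the Fourier series of the Bernoulli polynomial `B₂`, which has mean zero. Accordingly
the term `n = 0` is `1 / 0 = 0`. -/
theorem hasSum_one_div_sq_mul_zpow {t : ℝ} (ht : t ∈ Set.Icc (0 : ℝ) 1) {w : Circle}
    (hw : w = Circle.exp (2 * Real.pi * t)) :
    HasSum (fun n : ℤ => 1 / (n : ℂ) ^ 2 * (w : ℂ) ^ n)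
      (2 * (Real.pi : ℂ) ^ 2 * ((t : ℂ) ^ 2 - t + 6⁻¹)) := by
  convert hasSum_one_div_pow_mul_fourier_mul_bernoulliFun le_rfl ht using 1
  · funext n
    rw [fourier_coe_apply, hw, Circle.coe_exp, ← Complex.exp_int_mul]
    congr 2
    push_cast
    ring
  · rw [bernoulliFun_two]
    push_cast
    rw [mul_pow, Complex.I_sq, Nat.factorial_two]
    push_cast
    ring

theorem summable_norm_one_div_int_sq : Summable fun n : ℤ => ‖1 / (n : ℂ) ^ 2‖ := by
  have : (fun n : ℤ => ‖1 / (n : ℂ) ^ 2‖) = fun n : ℤ => 1 / (n : ℝ) ^ 2 := by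
    funext n
    rw [norm_div, norm_one, norm_pow, Complex.norm_intCast, sq_abs]
  rw [this]
  exact Real.summable_one_div_int_pow.2 one_lt_two

/-- There are functions with absolutely summable Fourier coefficients that vanish outside a
given neighbourhood of a point, but not at the point. -/
theorem exists_summable_hasSum_zpow {z₀ : Circle} {V : Set Circle} (hV : V ∈ nhds z₀) :
    ∃ (c : ℤ → ℂ) (g : Circle → ℂ), (Summable fun n => ‖c n‖) ∧
      (∀ z : Circle, HasSum (fun n : ℤ => c n * (z : ℂ) ^ n) (g z)) ∧ g z₀ ≠ 0 ∧
      ∀ z ∉ V, g z = 0 := by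
  obtain ⟨h, hh0, hh1, hhV⟩ : ∃ h : ℝ, 0 < h ∧ h ≤ 1 / 2 ∧
      ∀ t : ℝ, |t| < h → z₀ * Circle.exp (2 * Real.pi * t) ∈ V := by
    have hc : Continuous fun t : ℝ => z₀ * Circle.exp (2 * Real.pi * t) := by fun_prop
    have hV' : (fun t : ℝ => z₀ * Circle.exp (2 * Real.pi * t)) ⁻¹' V ∈ nhds 0 :=
      hc.continuousAt (by simpa using hV)
    obtain ⟨ε, hε, hεV⟩ := Metric.mem_nhds_iff.1 hV'
    refine ⟨min ε (1 / 2), by positivity, min_le_right _ _, fun t ht => hεV ?_⟩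
    rw [Metric.mem_ball, Real.dist_0_eq_abs]
    exact ht.trans_le (min_le_left _ _)
  let e : ℝ → Circle := fun t => Circle.exp (2 * Real.pi * t)
  have he_add : ∀ s t, e (s + t) = e s * e t := fun s t => by
    simp only [e, mul_add, Circle.exp_add]
  have he_neg : ∀ s, e (-s) = (e s)⁻¹ := fun s => by
    simp only [e, mul_neg, Circle.exp_neg]
  have he_one : e 1 = 1 := by
    simp only [e, mul_one, Circle.exp_two_pi]
  let u : Circle := e h
  -- The function is a second difference, with step `h` and centred at `z₀`, of `2π² B₂`. Where `t -
  -- h` and `t + h` stay in `[0, 1]`, it equals the constant `2π² · 2h² = c₀`, which is subtracted.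
  -- At `t = 0` the kink of the periodic extension leaves `-4π² h`.
  let c₀ : ℂ := 4 * Real.pi ^ 2 * h ^ 2
  let c : ℤ → ℂ := fun n => 1 / (n : ℂ) ^ 2 * (((u / z₀ : Circle) : ℂ) ^ n +
    ((u⁻¹ / z₀ : Circle) : ℂ) ^ n - 2 * ((z₀⁻¹ : Circle) : ℂ) ^ n) - if n = 0 then c₀ else 0
  have hc : Summable fun n => ‖c n‖ := by
    have h2 : Summable fun n : ℤ => ‖if n = 0 then c₀ else 0‖ :=
      summable_of_ne_finset_zero (s := {0}) fun n hn => by simp [Finset.notMem_singleton.1 hn]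
    refine Summable.of_nonneg_of_le (fun _ => norm_nonneg _) (fun n => ?_)
      ((summable_norm_one_div_int_sq.mul_right 4).add h2)
    refine (norm_sub_le _ _).trans (add_le_add_left ?_ _)
    rw [norm_mul]
    refine mul_le_mul_of_nonneg_left ?_ (norm_nonneg _)
    refine (norm_sub_le _ _).trans ((add_le_add_left (norm_add_le _ _) _).trans ?_)
    rw [norm_mul, EllOne.norm_circle_zpow, EllOne.norm_circle_zpow, EllOne.norm_circle_zpow]
    norm_num
  have hsum : ∀ (z : Circle) {r s t : ℝ}, r ∈ Set.Icc (0 : ℝ) 1 → s ∈ Set.Icc (0 : ℝ) 1 →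
      t ∈ Set.Icc (0 : ℝ) 1 → u / z₀ * z = e r → u⁻¹ / z₀ * z = e s → z₀⁻¹ * z = e t →
      HasSum (fun n : ℤ => c n * (z : ℂ) ^ n) (2 * (Real.pi : ℂ) ^ 2 * (((r : ℂ) ^ 2 - r + 6⁻¹) +
        ((s : ℂ) ^ 2 - s + 6⁻¹) - 2 * ((t : ℂ) ^ 2 - t + 6⁻¹)) - c₀) := by
    intro z r s t hr hs ht hzr hzs hzt
    have h1 := ((hasSum_one_div_sq_mul_zpow hr hzr).add (hasSum_one_div_sq_mul_zpow hs hzs)).sub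
      ((hasSum_one_div_sq_mul_zpow ht hzt).mul_left 2)
    have h2 : HasSum (fun n : ℤ => (if n = 0 then c₀ else 0) * (z : ℂ) ^ n) c₀ := by
      convert hasSum_single (f := fun n : ℤ => (if n = 0 then c₀ else 0) * (z : ℂ) ^ n) 0
        (fun n hn => by simp [hn]) using 1
      simp
    have h3 : 2 * (Real.pi : ℂ) ^ 2 * (((r : ℂ) ^ 2 - r + 6⁻¹) + ((s : ℂ) ^ 2 - s + 6⁻¹) -
        2 * ((t : ℂ) ^ 2 - t + 6⁻¹)) - c₀ = 2 * (Real.pi : ℂ) ^ 2 * ((r : ℂ) ^ 2 - r + 6⁻¹) +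
        2 * (Real.pi : ℂ) ^ 2 * ((s : ℂ) ^ 2 - s + 6⁻¹) -
        2 * (2 * (Real.pi : ℂ) ^ 2 * ((t : ℂ) ^ 2 - t + 6⁻¹)) - c₀ := by ring
    rw [h3]
    refine (h1.sub h2).congr_fun fun n => ?_
    simp only [c, Circle.coe_mul, mul_zpow]
    ring
  have hg0 : HasSum (fun n : ℤ => c n * (z₀ : ℂ) ^ n) (-(4 * Real.pi ^ 2 * h)) := by
    convert hsum z₀ (r := h) (s := 1 - h) (t := 0) ⟨hh0.le, by linarith⟩
      ⟨by linarith, by linarith⟩ ⟨le_rfl, zero_le_one⟩ (by simp [u])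
      (by rw [sub_eq_add_neg, he_add, he_one, he_neg]; simp [u]) (by simp [e]) using 1
    push_cast
    simp only [c₀]
    ring
  have hgV : ∀ z ∉ V, HasSum (fun n : ℤ => c n * (z : ℂ) ^ n) 0 := by
    intro z hz
    obtain ⟨θ, hθ⟩ := Circle.exp_surjective (z₀⁻¹ * z)
    have hfr : z₀⁻¹ * z = e (Int.fract (θ / (2 * Real.pi))) := by
      rw [← hθ, Circle.exp_eq_exp]
      refine ⟨⌊θ / (2 * Real.pi)⌋, ?_⟩
      rw [Int.fract]
      field_simp
      ring
    have hz' : z = z₀ * e (Int.fract (θ / (2 * Real.pi))) := by rw [← hfr, mul_inv_cancel_left]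
    have ht0 := Int.fract_nonneg (θ / (2 * Real.pi))
    have ht1 := Int.fract_lt_one (θ / (2 * Real.pi))
    generalize Int.fract (θ / (2 * Real.pi)) = t at hfr hz' ht0 ht1
    have hth : h ≤ t := by
      by_contra! hlt
      exact hz (hz' ▸ hhV t (by rwa [abs_of_nonneg ht0]))
    -- Values of `t` close to `1` represent points close to `z₀` from the other side, through `t -
    -- 1`.
    have hth' : t ≤ 1 - h := by
      by_contra! hlt
      have h1 : e (t - 1) = e t := by rw [sub_eq_add_neg, he_add, he_neg, he_one, inv_one, mul_one]
      refine hz (hz' ▸ h1 ▸ hhV (t - 1) ?_)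
      rw [abs_lt]
      constructor <;> linarith
    convert hsum z (r := t + h) (s := t - h) (t := t) ⟨by linarith, by linarith⟩
      ⟨by linarith, by linarith⟩ ⟨ht0, ht1.le⟩
      (by rw [he_add, ← hfr, div_eq_mul_inv, mul_assoc, mul_comm])
      (by rw [sub_eq_add_neg, he_add, he_neg, ← hfr, div_eq_mul_inv, mul_assoc, mul_comm])
      hfr using 1
    push_cast
    simp only [c₀]
    ring
  refine ⟨c, fun z => ∑' n : ℤ, c n * (z : ℂ) ^ n, hc, fun z => ?_, ?_, fun z hz => (hgV z hz).tsum_eq⟩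
  · refine (Summable.of_norm ?_).hasSum
    simpa only [norm_mul, EllOne.norm_circle_zpow, mul_one] using hc
  · refine hg0.tsum_eq.trans_ne (neg_ne_zero.2 ?_)
    exact mul_ne_zero (mul_ne_zero (by norm_num) (pow_ne_zero 2 (Complex.ofReal_ne_zero.2
      Real.pi_ne_zero))) (Complex.ofReal_ne_zero.2 hh0.ne')

/-! ### The structure space of `ℓ¹(Σ)` -/

section OrbitSpaceTopology

variable {X : Type*} [TopologicalSpace X] {σ : X ≃ₜ X}

theorem OrbitSpace.mk_eq_mk_iff {x y : X} :
    OrbitSpace.mk σ x = OrbitSpace.mk σ y ↔ ∃ n : ℤ, (σ ^ n) x = y :=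
  Quotient.eq (r := dynOrbitSetoid σ)

theorem OrbitSpace.mk_zpow_apply (n : ℤ) (x : X) :
    OrbitSpace.mk σ ((σ ^ n) x) = OrbitSpace.mk σ x :=
  (OrbitSpace.mk_eq_mk_iff.2 ⟨n, rfl⟩).symm

/-- The saturation of an open set is the union of its translates. Openness ensures that the product
with the identity of the circle is again a quotient map. -/
theorem OrbitSpace.isOpenQuotientMap_mk : IsOpenQuotientMap (OrbitSpace.mk σ) where
  surjective := Quotient.mk_surjective
  continuous := continuous_quot_mk
  isOpenMap U hU := by
    change IsOpen (OrbitSpace.mk σ ⁻¹' (OrbitSpace.mk σ '' U))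
    have : OrbitSpace.mk σ ⁻¹' (OrbitSpace.mk σ '' U) = ⋃ n : ℤ, (σ ^ n) ⁻¹' U := by
      ext x
      simp only [Set.mem_preimage, Set.mem_image, Set.mem_iUnion]
      constructor
      · rintro ⟨y, hy, hyx⟩
        obtain ⟨n, hn⟩ := OrbitSpace.mk_eq_mk_iff.1 hyx.symm
        exact ⟨n, hn ▸ hy⟩
      · rintro ⟨n, hn⟩
        exact ⟨_, hn, OrbitSpace.mk_zpow_apply n x⟩
    rw [this]
    exact isOpen_iUnion fun n => hU.preimage (σ ^ n).continuous

theorem HasExactPeriod.t1Space_orbitSpace [T1Space X] {p : ℕ} (hσ : HasExactPeriod σ p) :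
    T1Space (OrbitSpace σ) where
  t1 y := by
    obtain ⟨x, rfl⟩ := OrbitSpace.isOpenQuotientMap_mk.surjective y
    rw [← OrbitSpace.isOpenQuotientMap_mk.isQuotientMap.isClosed_preimage]
    refine Set.Finite.isClosed (((Finset.range p).finite_toSet.image
      fun i : ℕ => (σ ^ (i : ℤ)) x).subset fun y hy => ?_)
    obtain ⟨n, rfl⟩ := OrbitSpace.mk_eq_mk_iff.1 (Set.mem_singleton_iff.1 hy).symm
    obtain ⟨i, hi, m, rfl⟩ := hσ.exists_natCast_add n
    exact ⟨i, hi, by rw [Homeomorph.zpow_add_apply, hσ.zpow_mul_apply]⟩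

end OrbitSpaceTopology

namespace EllOne

variable {X : Type*} [TopologicalSpace X] [CompactSpace X] [T2Space X] {σ : X ≃ₜ X} {p : ℕ}

/-- Elements whose image under the Gelfand-type transform `fiberCoeff` is supported near a given
point. -/
theorem exists_fiberCoeff_ne_zero (hσ : HasExactPeriod σ p) {x₀ : X} {z₀ : Circle} {U : Set X}
    (hU : IsOpen U) (hUσ : ∀ (n : ℤ) (x : X), (σ ^ n) x ∈ U ↔ x ∈ U) (hx₀ : x₀ ∈ U)
    {V : Set Circle} (hV : V ∈ nhds z₀) :
    ∃ a : EllOne σ, fiberCoeff p z₀ 0 a x₀ ≠ 0 ∧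
      ∀ x z, (x ∈ U → z ∉ V) → ∀ j n : ℤ, fiberCoeff p z j a ((σ ^ n) x) = 0 := by
  obtain ⟨c, g, hc, hg, hg₀, hgV⟩ := exists_summable_hasSum_zpow hV
  obtain ⟨f, hf1, hf0, hfn⟩ := exists_continuousMap_eq_one_of_mem_isOpen hU hx₀
  let fc : C(X, ℂ) := ⟨fun y => (f y : ℂ), by fun_prop⟩
  let F : C(X, ℂ) := orbitSum σ p fc
  have hF0 : ∀ x ∉ U, F x = 0 := fun x hx => by
    rw [orbitSum_apply]
    refine Finset.sum_eq_zero fun i _ => ?_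
    change (f _ : ℂ) = 0
    rw [hf0 _ (by rwa [hUσ]), Complex.ofReal_zero]
  have hF1 : F x₀ ≠ 0 := by
    have : F x₀ = ((∑ i ∈ Finset.range p, f ((σ ^ (-(i : ℤ))) x₀) : ℝ) : ℂ) := by
      rw [orbitSum_apply, Complex.ofReal_sum]
      rfl
    rw [this, Complex.ofReal_ne_zero]
    refine ((?_ : (0 : ℝ) < 1).trans_le ?_).ne'
    · exact one_pos
    · refine le_trans ?_ (Finset.single_le_sum (fun i _ => hfn _) (Finset.mem_range.2 hσ.pos))
      simp [hf1]
  have hs : Summable fun m : ℤ => c m • single σ (p * m) F := by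
    refine Summable.of_norm_bounded (hc.mul_right ‖F‖) fun m => ?_
    rw [norm_smul]
    exact mul_le_mul_of_nonneg_left (norm_single_le _ _) (norm_nonneg _)
  -- This is `F · g(δ ^ p)`: its coefficient modulo `δ ^ p = z` is `g z • F` for `j = 0` and zero
  -- for `j` outside `p ℤ`.
  let a : EllOne σ := ∑' m : ℤ, c m • single σ (p * m) F
  have ha : ∀ z x, fiberCoeff p z 0 a x = g z * F x := fun z x => by
    have h1 := ((hs.hasSum.map (fiberCoeffL σ p z 0 hσ.pos) (fiberCoeffL σ p z 0 hσ.pos).continuous).map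
      (ContinuousMap.evalCLM ℂ x) (ContinuousMap.evalCLM ℂ x).continuous)
    refine h1.unique (((hg z).mul_right (F x)).congr_fun fun m => ?_)
    simp only [Function.comp_apply, map_smul, fiberCoeffL_apply]
    rw [fiberCoeff_single_of_eq z hσ.pos (zero_add _).symm, map_smul]
    simp [ContinuousMap.evalCLM_apply, mul_assoc]
  have ha' : ∀ z (j : ℤ), ¬ (p : ℤ) ∣ j → fiberCoeff p z j a = 0 := fun z j hj => by
    have h1 := hs.hasSum.map (fiberCoeffL σ p z j hσ.pos) (fiberCoeffL σ p z j hσ.pos).continuous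
    refine h1.unique (hasSum_zero.congr_fun fun m => ?_)
    simp only [Function.comp_apply, map_smul, fiberCoeffL_apply]
    rw [fiberCoeff_single_of_not_dvd, smul_zero]
    rwa [dvd_sub_right (dvd_mul_right _ _)]
  refine ⟨a, ?_, fun x z hxz j n => ?_⟩
  · rw [ha]
    exact mul_ne_zero hg₀ hF1
  · by_cases hj : (p : ℤ) ∣ j
    · obtain ⟨m, rfl⟩ := hj
      rw [← zero_add ((p : ℤ) * m), fiberCoeff_add_mul, ContinuousMap.smul_apply, ha]
      by_cases hx : x ∈ U
      · rw [hgV z (hxz hx), zero_mul, smul_zero]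
      · rw [hF0 _ (by rwa [hUσ]), mul_zero, smul_zero]
    · rw [ha' z j hj, ContinuousMap.zero_apply]

/-! ### The bijection between pairs (orbit, scalar) and primitive ideals, and its topology -/

section PrimIdeal

variable (hσ : HasExactPeriod σ p)

/-- The primitive ideal attached to a point and a scalar. -/
noncomputable def primIdeal (x : X) (z : Circle) : StructureSpace (EllOne σ) :=
  ⟨TwoSidedIdeal.ker (rep hσ x z), (isAlgIrreducible_rep hσ x z).isPrimitiveIdeal_ker⟩

theorem mem_primIdeal {x : X} {z : Circle} {a : EllOne σ} :
    a ∈ (primIdeal hσ x z).1 ↔ ∀ j n : ℤ, fiberCoeff p z j a ((σ ^ n) x) = 0 := by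
  rw [← rep_eq_zero_iff hσ x z]
  exact TwoSidedIdeal.mem_ker _

theorem primIdeal_zpow_apply (n : ℤ) (x : X) (z : Circle) :
    primIdeal hσ ((σ ^ n) x) z = primIdeal hσ x z := by
  refine Subtype.ext (TwoSidedIdeal.ext fun a => ?_)
  rw [mem_primIdeal, mem_primIdeal]
  refine forall_congr' fun j => ⟨fun h m => ?_, fun h m => ?_⟩
  · have := h (m - n)
    rwa [← Homeomorph.zpow_add_apply, sub_add_cancel] at this
  · rw [← Homeomorph.zpow_add_apply]
    exact h _

/-- The primitive ideal attached to an orbit and a scalar. -/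
noncomputable def orbitPrimIdeal (y : OrbitSpace σ × Circle) : StructureSpace (EllOne σ) :=
  Quotient.lift (s := dynOrbitSetoid σ) (fun x => primIdeal hσ x y.2)
    (by
      rintro x _ ⟨n, rfl⟩
      exact (primIdeal_zpow_apply hσ n x y.2).symm) y.1

theorem orbitPrimIdeal_mk (x : X) (z : Circle) :
    orbitPrimIdeal hσ (OrbitSpace.mk σ x, z) = primIdeal hσ x z := rfl

theorem isClosed_mem_orbitPrimIdeal (a : EllOne σ) :
    IsClosed {y | a ∈ (orbitPrimIdeal hσ y).1} := by
  have hq : IsOpenQuotientMap (Prod.map (OrbitSpace.mk σ) (id : Circle → Circle)) :=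
    OrbitSpace.isOpenQuotientMap_mk.prodMap .id
  rw [← hq.isQuotientMap.isClosed_preimage]
  have : Prod.map (OrbitSpace.mk σ) (id : Circle → Circle) ⁻¹' {y | a ∈ (orbitPrimIdeal hσ y).1} =
      ⋂ (j : ℤ) (n : ℤ), {y : X × Circle | fiberCoeff p y.2 j a ((σ ^ n) y.1) = 0} := by
    ext ⟨x, z⟩
    simp only [Set.mem_iInter]
    exact mem_primIdeal hσ
  rw [this]
  refine isClosed_iInter fun j => isClosed_iInter fun n => isClosed_eq ?_ continuous_const
  exact (continuous_fiberCoeff_apply p j hσ.pos a).comp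
    (((σ ^ n).continuous.comp continuous_fst).prodMk continuous_snd)

/-- If `y` is outside `closure S`, a product neighbourhood of `y` avoids `S`, and
`exists_fiberCoeff_ne_zero` yields an element in every ideal from `S` but not in that of `y`. The
converse holds because the pairs whose ideal contains a given `a` form a closed set. -/
theorem orbitPrimIdeal_mem_closure_image_iff (S : Set (OrbitSpace σ × Circle))
    (y : OrbitSpace σ × Circle) :
    orbitPrimIdeal hσ y ∈ closure (orbitPrimIdeal hσ '' S) ↔ y ∈ closure S := by
  rw [StructureSpace.closure_eq]
  refine ⟨fun h => ?_, fun h a ha => ?_⟩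
  · by_contra hy
    obtain ⟨y, z₀⟩ := y
    obtain ⟨x₀, rfl⟩ := OrbitSpace.isOpenQuotientMap_mk.surjective y
    obtain ⟨U, V, hU, hV, hx₀, hz₀, hUV⟩ := isOpen_prod_iff.1 isClosed_closure.isOpen_compl _ _ hy
    obtain ⟨a, ha, haUV⟩ := exists_fiberCoeff_ne_zero hσ
      (hU.preimage OrbitSpace.isOpenQuotientMap_mk.continuous)
      (fun n x => by rw [Set.mem_preimage, OrbitSpace.mk_zpow_apply, Set.mem_preimage]) hx₀
      (hV.mem_nhds hz₀)
    refine ha ((mem_primIdeal hσ).1 (h a ?_) 0 0)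
    rintro _ ⟨⟨s, z⟩, hs, rfl⟩
    obtain ⟨x, rfl⟩ := OrbitSpace.isOpenQuotientMap_mk.surjective s
    exact (mem_primIdeal hσ).2 (haUV x z fun hx hz => hUV (Set.mk_mem_prod hx hz) (subset_closure hs))
  · exact closure_minimal (fun s hs => ha _ ⟨s, hs, rfl⟩) (isClosed_mem_orbitPrimIdeal hσ a) h

theorem orbitPrimIdeal_bijective [Nonempty X] : Function.Bijective (orbitPrimIdeal hσ) := by
  have := hσ.t1Space_orbitSpace
  refine ⟨fun y₁ y₂ h => ?_, fun P => ?_⟩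
  · have h1 : orbitPrimIdeal hσ y₁ ∈ closure (orbitPrimIdeal hσ '' {y₂}) :=
      subset_closure ⟨y₂, rfl, h.symm⟩
    rwa [orbitPrimIdeal_mem_closure_image_iff, closure_singleton] at h1
  · obtain ⟨P, E, _, _, π, hπ, rfl⟩ := P
    obtain ⟨x, z, h⟩ := exists_map_eq_zero_iff hσ hπ
    refine ⟨(OrbitSpace.mk σ x, z), Subtype.ext (TwoSidedIdeal.ext fun a => ?_)⟩
    rw [orbitPrimIdeal_mk, mem_primIdeal, ← h]
    exact (TwoSidedIdeal.mem_ker _).symm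

/-- The structure space of `ℓ¹(Σ)` is the product of the orbit space and the circle. -/
noncomputable def structureSpaceHomeomorph [Nonempty X] :
    OrbitSpace σ × Circle ≃ₜ StructureSpace (EllOne σ) :=
  (Equiv.ofBijective _ (orbitPrimIdeal_bijective hσ)).toHomeomorphOfContinuousClosed
    (by
      rw [continuous_iff_image_closure_subset_closure_image]
      rintro S _ ⟨y, hy, rfl⟩
      exact (orbitPrimIdeal_mem_closure_image_iff hσ S y).2 hy)
    (by
      intro S hS
      refine isClosed_of_closure_subset fun P hP => ?_
      obtain ⟨y, rfl⟩ := (orbitPrimIdeal_bijective hσ).2 P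
      refine ⟨y, ?_, rfl⟩
      rw [← hS.closure_eq]
      exact (orbitPrimIdeal_mem_closure_image_iff hσ S y).1 hP)

end PrimIdeal

end EllOne

/-! ### Rational rotations -/

theorem mulLeft_zpow_apply {G : Type*} [TopologicalSpace G] [Group G] [SeparatelyContinuousMul G]
    (c : G) (n : ℤ) (z : G) : (Homeomorph.mulLeft c ^ n) z = c ^ n * z := by
  induction n using Int.induction_on generalizing z with
  | zero => simp
  | succ n ih => rw [zpow_add_one, Homeomorph.mul_apply, ih, zpow_add_one, mul_assoc]; rfl
  | pred n ih =>
    have h := ih ((Homeomorph.mulLeft c)⁻¹ z)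
    rw [zpow_sub_one, Homeomorph.mul_apply, h, zpow_sub_one, mul_assoc]
    rfl

theorem Circle.exp_zpow (t : ℝ) (n : ℤ) : Circle.exp t ^ n = Circle.exp (n * t) := by
  rw [← zsmul_eq_mul]
  exact (map_zsmul Circle.expHom n t).symm

section Rotation

variable {p q : ℤ}

theorem ratRotation_zpow_apply (p q n : ℤ) (z : Circle) :
    (ratRotation p q ^ n) z = Circle.exp (2 * Real.pi * (n * p / q)) * z := by
  rw [ratRotation, mulLeft_zpow_apply, Circle.exp_zpow]
  congr 2
  ring

theorem circle_exp_two_pi_mul_div_eq_one_iff (hq : q ≠ 0) {n : ℤ} :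
    Circle.exp (2 * Real.pi * (n / q)) = 1 ↔ q ∣ n := by
  have hq' : (q : ℝ) ≠ 0 := by exact_mod_cast hq
  have hπ := Real.pi_ne_zero
  rw [Circle.exp_eq_one]
  refine exists_congr fun m => ?_
  rw [mul_comm (m : ℝ), mul_right_inj' (by positivity), div_eq_iff hq', mul_comm (m : ℝ)]
  norm_cast

/-- By coprimality `q ∣ n * p` is equivalent to `q ∣ n`. The sign of `q` is arbitrary, hence the
absolute value. -/
theorem hasExactPeriod_ratRotation (hq : q ≠ 0) (hpq : IsCoprime p q) :
    HasExactPeriod (ratRotation p q) q.natAbs where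
  pos := Int.natAbs_pos.2 hq
  zpow_apply_eq_self_iff z n := by
    rw [ratRotation_zpow_apply, mul_eq_right, Int.natAbs_dvd, ← Int.cast_mul,
      circle_exp_two_pi_mul_div_eq_one_iff hq]
    exact ⟨fun h => hpq.symm.dvd_of_dvd_mul_right h, fun h => h.mul_right p⟩

theorem zpow_eq_zpow_iff_exists_ratRotation (hq : q ≠ 0) (hpq : IsCoprime p q) {z w : Circle} :
    z ^ q = w ^ q ↔ ∃ n : ℤ, (ratRotation p q ^ n) w = z := by
  have hq' : (q : ℝ) ≠ 0 := by exact_mod_cast hq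
  simp only [ratRotation_zpow_apply]
  constructor
  · intro h
    obtain ⟨θ, hθ⟩ := Circle.exp_surjective (z / w)
    have h1 : Circle.exp (q * θ) = 1 := by
      rw [← Circle.exp_zpow, hθ, div_zpow, h, div_self']
    obtain ⟨k, hk⟩ := Circle.exp_eq_one.1 h1
    obtain ⟨a, b, hab⟩ := hpq
    -- Here `z / w` has angle `2π k / q`, and Bézout's identity `a p + b q = 1` gives `k / q = (k a)
    -- p / q + k b`, so `k a` rotations suffice modulo full turns.
    refine ⟨k * a, ?_⟩
    rw [← eq_div_iff_mul_eq', ← hθ, Circle.exp_eq_exp]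
    refine ⟨-(k * b), ?_⟩
    have hab' : (a : ℝ) * p + b * q = 1 := by exact_mod_cast hab
    have hθ' : θ = 2 * Real.pi * (k * (a * p + b * q) / q) := by
      rw [hab']
      field_simp
      linarith
    rw [hθ']
    push_cast
    field_simp
    ring
  · rintro ⟨n, rfl⟩
    rw [mul_zpow, Circle.exp_zpow]
    have : (q : ℝ) * (2 * Real.pi * (n * p / q)) = (n * p : ℤ) * (2 * Real.pi) := by
      push_cast
      field_simp
    rw [this, Circle.exp_int_mul_two_pi, one_mul]

theorem dynOrbit_ratRotation (hq : q ≠ 0) (hpq : IsCoprime p q) (z₀ : Circle) :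
    dynOrbit (ratRotation p q) z₀ = {z | z ^ q = z₀ ^ q} :=
  Set.ext fun _ => (zpow_eq_zpow_iff_exists_ratRotation hq hpq).symm

/-- The orbit space of a rational rotation is a circle. -/
noncomputable def orbitSpaceRatRotationHomeomorph (hq : q ≠ 0) (hpq : IsCoprime p q) :
    OrbitSpace (ratRotation p q) ≃ₜ Circle :=
  have : CompactSpace (OrbitSpace (ratRotation p q)) :=
    OrbitSpace.isOpenQuotientMap_mk.surjective.compactSpace
      OrbitSpace.isOpenQuotientMap_mk.continuous
  let f : OrbitSpace (ratRotation p q) → Circle :=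
    Quotient.lift (s := dynOrbitSetoid (ratRotation p q)) (fun z : Circle => z ^ q) fun _ _ h =>
      ((zpow_eq_zpow_iff_exists_ratRotation hq hpq).2 h).symm
  have hf : Function.Bijective f := by
    constructor
    · intro y₁ y₂ h
      obtain ⟨z, rfl⟩ := OrbitSpace.isOpenQuotientMap_mk.surjective y₁
      obtain ⟨w, rfl⟩ := OrbitSpace.isOpenQuotientMap_mk.surjective y₂
      exact OrbitSpace.mk_eq_mk_iff.2 ((zpow_eq_zpow_iff_exists_ratRotation hq hpq).1 h.symm)
    · intro w
      obtain ⟨θ, rfl⟩ := Circle.exp_surjective w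
      refine ⟨OrbitSpace.mk _ (Circle.exp (θ / q)), ?_⟩
      change Circle.exp (θ / q) ^ q = _
      rw [Circle.exp_zpow, mul_div_cancel₀]
      exact_mod_cast hq
  Continuous.homeoOfEquivCompactToT2 (f := Equiv.ofBijective f hf)
    (OrbitSpace.isOpenQuotientMap_mk.isQuotientMap.continuous_iff.2 (continuous_zpow q))

theorem orbitSpaceRatRotationHomeomorph_mk (hq : q ≠ 0) (hpq : IsCoprime p q) (z : Circle) :
    orbitSpaceRatRotationHomeomorph hq hpq (OrbitSpace.mk (ratRotation p q) z) = z ^ q := rfl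

end Rotation

theorem mainTheorem8 :
    (∀ (X : Type*) [TopologicalSpace X] [CompactSpace X] [T2Space X] [Nonempty X]
        (σ : X ≃ₜ X) (p : ℕ),
        (∀ x : X, (dynOrbit σ x).encard = (p : ℕ∞)) →
        Nonempty (StructureSpace (EllOne σ) ≃ₜ OrbitSpace σ × Circle)) ∧
    (∀ p q : ℤ, q ≠ 0 → IsCoprime p q →
        (∀ z₀ : Circle, dynOrbit (ratRotation p q) z₀ = {z : Circle | z ^ q = z₀ ^ q}) ∧
        (∃ Φ : OrbitSpace (ratRotation p q) ≃ₜ Circle,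
          ∀ z : Circle, Φ (OrbitSpace.mk (ratRotation p q) z) = z ^ q) ∧
        Nonempty (StructureSpace (EllOne (ratRotation p q)) ≃ₜ
          OrbitSpace (ratRotation p q) × Circle) ∧
        Nonempty (StructureSpace (EllOne (ratRotation p q)) ≃ₜ Circle × Circle)) := by
  refine ⟨fun X _ _ _ _ σ p h =>
    ⟨(EllOne.structureSpaceHomeomorph (HasExactPeriod.of_encard h)).symm⟩, fun p q hq hpq => ?_⟩
  have e := (EllOne.structureSpaceHomeomorph (hasExactPeriod_ratRotation hq hpq)).symm
  have Φ := orbitSpaceRatRotationHomeomorph hq hpq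
  exact ⟨dynOrbit_ratRotation hq hpq, ⟨orbitSpaceRatRotationHomeomorph hq hpq,
    orbitSpaceRatRotationHomeomorph_mk hq hpq⟩, ⟨e⟩, ⟨e.trans (Φ.prodCongr (Homeomorph.refl _))⟩⟩
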